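/- All logarithms are natural and capacity is measured in nats per input bit. For $d\in(0,1)$, the Poisson-repeat channel with deletion probability $d$ replaces each bit of its input word, independently, by $D$ copies of that bit, where $D$ is Poisson with mean $\lambda=\log(1/d)$, and outputs the concatenation. Its capacity is $\mathrm{Cap}_d:=\lim_{n\to\infty}\frac1n\sup I(X;Y)$, the supremum being over all distributions of the $n$-bit input $X$, with $Y$ the output word (read the limit as an upper limit). For $q\in(0,1)$ let $Y$ be a random variable on $\{0,1,2,\dots\}$ distributed according to either (a) $\Pr[Y=y]=y_0\,\frac{y^y}{y!}(q/e)^y$ with $0^0:=1$, or (b) the digamma distribution $\Pr[Y=0]=y_0$, $\Pr[Y=y]=y_0\,\frac{e^{y\psi(y)}}{y!}(q/e)^y$ for $y\ge 1$, with $\psi=\Gamma'/\Gamma$, where $y_0=y_0(q)$ is the normalizing constant, and let $\mu=\mu(q)=\mathbb E[Y]$. Theorem. Let $d\in(0,1)$. In both cases (a) and (b), for every $q\in(0,1)$ the distribution is well defined and has finite mean, and $$\mathrm{Cap}_d\le\sup_{q\in(0,1)}\frac{-\mu\log q-\log y_0}{-\mu/\log d+1/(1-d)}.$$ Furthermore,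 let $\underline\gamma:=2/e^{1+\gamma}$ and $\overline\gamma:=1/\sqrt{2e}$, where $\gamma$ is the Euler–Mascheroni constant. Then $$\mathrm{Cap}_d\le\sup_{q\in(0,1)}\frac{-\overline\mu\log q-\log\underline{y_0}}{-\underline\mu/\log d+1/(1-d)},$$ where $$\overline\mu:=\frac{\overline\gamma\,q}{2(1-q)\left(\sqrt{1-q}+\underline\gamma(1-\sqrt{1-q})\right)},\qquad \underline\mu:=\frac{\underline\gamma\,q}{2(1-q)\left(\sqrt{1-q}+\overline\gamma(1-\sqrt{1-q})\right)},$$ $$\underline{y_0}:=\left(1+\overline\gamma\left(\frac1{\sqrt{1-q}}-1\right)\right)^{-1}.$$ -/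

import Mathlib

open scoped ENNReal

noncomputable section

/-- The `D`-repeat channel: each input bit is replaced, independently of the others, by a number of
copies of itself with law `D`; the output is the concatenation. Given an input word, this is the
law of the output word. -/
def repeatChannel (D : PMF ℕ) : List Bool → PMF (List Bool)
  | [] => PMF.pure []
  | b :: w => D.bind fun k => (repeatChannel D w).map fun v => List.replicate k b ++ v

/-- Mutual information `I(X;Y) = ∑ₓ P(x) D(Yₓ ‖ Y)` (in nats), where the input `X` has the discrete
law `P`, the output `Yₓ` given the input `x` has the discrete law `W x`, and `Y` has the output law
`∑ₓ P(x) W x`. -/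
def mutualInfo {α β : Type*} (P : PMF α) (W : α → PMF β) : ℝ≥0∞ :=
  letI : MeasurableSpace β := ⊤
  ∑' x, P x * InformationTheory.klDiv (W x).toMeasure (P.bind W).toMeasure

/-- Capacity of the `D`-repeat channel, in nats per input bit: the limit as `n → ∞` of `1 / n` times
the supremum of `I(X;Y)` over all laws of an `n`-bit input `X`. It is written as an upper limit, so
that an upper bound for it needs no separate proof that the limit exists. -/
def repeatCapacity (D : PMF ℕ) : ℝ≥0∞ :=
  Filter.limsup
    (fun n : ℕ => (⨆ P : PMF (Fin n → Bool),
      mutualInfo P fun x => repeatChannel D (List.ofFn x)) / (n : ℝ≥0∞))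
    Filter.atTop

/-- The Poisson law with mean `r` as a discrete law on `ℕ`. -/
def poissonLaw (r : NNReal) : PMF ℕ := (ProbabilityTheory.poissonMeasure r).toPMF

/-- Capacity of the Poisson-repeat channel with deletion probability `d`, that is, with Poisson
repetitions of mean `log (1 / d)` per bit. -/
def poissonRepeatCapacity (d : ℝ) : ℝ≥0∞ :=
  repeatCapacity (poissonLaw (Real.log (1 / d)).toNNReal)

/-- The real digamma function `ψ = Γ' / Γ`. -/
def realDigamma (x : ℝ) : ℝ := deriv Real.Gamma x / Real.Gamma x

/-- Unnormalized mass function `(y ^ y / y!) (q / e) ^ y`, with `0 ^ 0 = 1`. -/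
def selfPowerWeight (q : ℝ) (y : ℕ) : ℝ :=
  (y : ℝ) ^ y / (y.factorial : ℝ) * (q / Real.exp 1) ^ y

/-- Unnormalized mass function of the digamma distribution: `1` at `y = 0`, and
`exp (y ψ(y)) (q / e) ^ y / y!` for `y > 0`. -/
def digammaWeight (q : ℝ) (y : ℕ) : ℝ :=
  if y = 0 then 1
  else Real.exp (y * realDigamma y) * (q / Real.exp 1) ^ y / (y.factorial : ℝ)

/-- The normalizing constant `y₀` of the law proportional to the weights `w`. -/
def normConst (w : ℕ → ℝ) : ℝ := (∑' y, w y)⁻¹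

/-- The mass function `y₀ w(y)` of the law proportional to the weights `w`. -/
def lawOf (w : ℕ → ℝ) (y : ℕ) : ℝ := normConst w * w y

/-- The mean of the law proportional to the weights `w`. -/
def meanOf (w : ℕ → ℝ) : ℝ := ∑' y : ℕ, (y : ℝ) * lawOf w y

/-- `γ̲ = 2 / e ^ (1 + γ)`. -/
def gammaLo : ℝ := 2 / Real.exp (1 + Real.eulerMascheroniConstant)

/-- `γ̄ = 1 / √(2 e)`. -/
def gammaHi : ℝ := 1 / √(2 * Real.exp 1)

/-- The elementary upper estimate `μ̄` of the mean of the digamma distribution. -/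
def muHi (q : ℝ) : ℝ :=
  gammaHi * q / (2 * (1 - q) * (√(1 - q) + gammaLo * (1 - √(1 - q))))

/-- The elementary lower estimate `μ̲` of the mean of the digamma distribution. -/
def muLo (q : ℝ) : ℝ :=
  gammaLo * q / (2 * (1 - q) * (√(1 - q) + gammaHi * (1 - √(1 - q))))

/-- The elementary lower estimate of the normalizing constant `y₀` of the digamma distribution. -/
def y0Lo (q : ℝ) : ℝ := (1 + gammaHi * (1 / √(1 - q) - 1))⁻¹

end

/-! Capacity is bounded by duality: for any reference law `Q` on output words, `I(X;Y)` is at most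
the largest divergence of an output law `W x` from `Q` (`mutualInfo_le_of_forall`). The reference
`runSource` has an initial run distributed as `Y`; each later run adds to a copy of `Y` an
independent positive Poisson length.

Suppose `D(Poisson(x) ‖ Y) ≤ B + A x` for all `x`. Read the input bit by bit, carrying the mean `r`
of the run being built (`pendingOutput`). A bit equal to the current one raises `r` by `λ = log
(1/d)`, at cost `A λ`. A different bit vanishes with probability `d` and changes nothing; otherwise
it closes the run, and the new run costs an extra `B`, on average `(1 - d) B`. If `A λ = (1 - d) B =
C`, every bit costs `C` whatever the word is. The number of runs costs only a logarithm, so the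
capacity is at most `C` (`discreteKL_pendingOutput_le`, `poissonRepeatCapacity_le`).

For weights `exp (g y) (q/e)^y / y!` with sum `S`, the divergence is `log S - x log q + x log x -
𝔼[g]`, so `A = -log q`, `B = log S` work once `𝔼[g] ≥ x log x`. For `g y = y log y` this is Jensen;
for `g y = y ψ(y)` it is `mul_log_le_tsum_poissonWeight_digamma`.

Continuity gives a `q` with `A λ = (1 - d) B` (`exists_balanced`). There the quotient `(μ A + B) /
(μ/λ + 1/(1 - d))` equals `C` for every `μ ≥ 0`, so the supremum is at least `C`. In the elementary
bound `S` is replaced by a majorant, obtained by comparison with central binomial coefficients. Only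
`0 ≤ μ̲ ≤ μ̄` is then needed; the two need not be compared with the true mean. -/

/-! ### Divergence of discrete laws: chain rule, data processing, duality. -/

section Divergence

open MeasureTheory ProbabilityTheory InformationTheory

/-- The contribution of a point of mass `s` and `t` to the Kullback-Leibler divergence. -/
noncomputable def klTerm (s t : ℝ≥0∞) : ℝ≥0∞ :=
  if t = 0 then (if s = 0 then 0 else ⊤) else t * ENNReal.ofReal (klFun (s / t).toReal)

theorem klTerm_mul_mul {m : ℝ≥0∞} (hm : m ≠ ⊤) (s t : ℝ≥0∞) :
    klTerm (m * s) (m * t) = m * klTerm s t := by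
  by_cases h0 : m = 0
  · simp [klTerm, h0]
  · unfold klTerm
    by_cases ht : t = 0
    · by_cases hs : s = 0 <;> simp [ht, hs, h0]
    · simp [ht, h0, ENNReal.mul_div_mul_left _ _ h0 hm, mul_assoc]

theorem klDiv_eq_tsum_klTerm {α : Type*} [Countable α] [MeasurableSpace α]
    [DiscreteMeasurableSpace α] (μ ν : Measure α) [IsFiniteMeasure μ] [IsFiniteMeasure ν] :
    klDiv μ ν = ∑' x, klTerm (μ {x}) (ν {x}) := by
  by_cases hac : μ ≪ ν
  · rw [klDiv_eq_lintegral_klFun_of_ac hac, lintegral_countable']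
    refine tsum_congr fun x => ?_
    by_cases hx : ν {x} = 0
    · simp [klTerm, hx, hac hx]
    · have h1 : ∫⁻ y in {x}, μ.rnDeriv ν y ∂ν = μ {x} := Measure.setLIntegral_rnDeriv hac _
      rw [lintegral_singleton] at h1
      have h2 : μ.rnDeriv ν x = μ {x} / ν {x} :=
        (ENNReal.eq_div_iff hx (measure_ne_top _ _)).2 (by rw [mul_comm, h1])
      simp [klTerm, hx, h2, mul_comm]
  · rw [klDiv_of_not_ac hac]
    obtain ⟨x, hν, hμ⟩ : ∃ x, ν {x} = 0 ∧ μ {x} ≠ 0 := by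
      by_contra! h
      refine hac fun s hs => ?_
      rw [← Set.biUnion_of_singleton s, measure_biUnion_null_iff s.to_countable]
      exact fun x hx => h x (measure_mono_null (by simpa using hx) hs)
    exact (top_le_iff.1 (le_trans (by simp [klTerm, hν, hμ])
      (ENNReal.le_tsum (f := fun x => klTerm (μ {x}) (ν {x})) x))).symm

/-- The pointwise divergence terms are homogeneous of degree one, so the factor `μ {a}` comes out of
the sum over `b`. -/
theorem klDiv_compProd_eq_tsum {α β : Type*} [Countable α] [Countable β] [MeasurableSpace α]
    [MeasurableSpace β] [DiscreteMeasurableSpace α] [DiscreteMeasurableSpace β]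
    (μ : Measure α) [IsFiniteMeasure μ] (κ η : Kernel α β) [IsFiniteKernel κ] [IsFiniteKernel η] :
    klDiv (μ ⊗ₘ κ) (μ ⊗ₘ η) = ∑' a, μ {a} * klDiv (κ a) (η a) := by
  have key : ∀ (ξ : Kernel α β) [IsFiniteKernel ξ] (a : α) (b : β),
      (μ ⊗ₘ ξ) {(a, b)} = μ {a} * ξ a {b} := fun ξ _ a b => by
    rw [← Set.singleton_prod_singleton, Measure.compProd_apply_prod (.singleton _) (.singleton _),
      lintegral_singleton, mul_comm]
  rw [klDiv_eq_tsum_klTerm, ENNReal.tsum_prod']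
  refine tsum_congr fun a => ?_
  rw [klDiv_eq_tsum_klTerm, ← ENNReal.tsum_mul_left]
  refine tsum_congr fun b => ?_
  rw [key, key, klTerm_mul_mul (measure_ne_top _ _)]

/-- Replacing the output law by any other law does not decrease the averaged divergence. -/
theorem tsum_klDiv_comp_le {α β : Type*} [Countable α] [Countable β] [MeasurableSpace α]
    [MeasurableSpace β] [DiscreteMeasurableSpace α] [DiscreteMeasurableSpace β]
    (μ : Measure α) [IsProbabilityMeasure μ] (κ : Kernel α β) [IsMarkovKernel κ]
    (ν : Measure β) [IsProbabilityMeasure ν] :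
    ∑' a, μ {a} * klDiv (κ a) (κ ∘ₘ μ) ≤ ∑' a, μ {a} * klDiv (κ a) ν := by
  have : Nonempty α := nonempty_of_isProbabilityMeasure μ
  have swap_swap : ∀ {γ δ : Type _} [MeasurableSpace γ] [MeasurableSpace δ] (ρ : Measure (γ × δ)),
      (ρ.map Prod.swap).map Prod.swap = ρ := fun ρ => by
    rw [Measure.map_map measurable_swap measurable_swap]; simp
  have swap_kl : ∀ (ρ₁ ρ₂ : Measure (α × β)) [IsFiniteMeasure ρ₁] [IsFiniteMeasure ρ₂],
      -- Data processing in both directions, since the swap is an involution.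
      klDiv (ρ₁.map Prod.swap) (ρ₂.map Prod.swap) = klDiv ρ₁ ρ₂ := fun ρ₁ ρ₂ _ _ => by
    refine le_antisymm (klDiv_map_le _ _ measurable_swap) ?_
    conv_lhs => rw [← swap_swap ρ₁, ← swap_swap ρ₂]
    exact klDiv_map_le _ _ measurable_swap
  have swap_const : ∀ (ξ : Measure β) [IsProbabilityMeasure ξ],
      (μ ⊗ₘ Kernel.const α ξ).map Prod.swap = ξ ⊗ₘ Kernel.const β μ := fun ξ _ => by
    rw [Measure.compProd_const, Measure.compProd_const, Measure.prod_swap]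
  have post : ∀ (ξ : Measure β) [IsProbabilityMeasure ξ],
      ∑' a, μ {a} * klDiv (κ a) ξ =
        klDiv ((κ ∘ₘ μ) ⊗ₘ posterior κ μ) (ξ ⊗ₘ Kernel.const β μ) := fun ξ _ => by
    rw [compProd_posterior_eq_map_swap, ← swap_const, swap_kl, klDiv_compProd_eq_tsum]
    simp
  -- Disintegrating over the output, the chain rule splits the right side into `klDiv (κ ∘ₘ μ) ν`
  -- plus the left side.
  rw [post, post, klDiv_compProd_eq_add (κ ∘ₘ μ) ν]
  exact le_add_self

/-- The Kullback-Leibler divergence of two discrete laws. -/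
noncomputable def discreteKL {α : Type*} (p q : PMF α) : ℝ≥0∞ :=
  letI : MeasurableSpace α := ⊤
  klDiv p.toMeasure q.toMeasure

@[simp]
theorem discreteKL_self {α : Type*} (p : PMF α) : discreteKL p p = 0 := by
  simp [discreteKL]

theorem discreteKL_eq_tsum {α : Type*} [Countable α] (p q : PMF α) :
    discreteKL p q = ∑' x, klTerm (p x) (q x) := by
  let _ : MeasurableSpace α := ⊤
  rw [discreteKL, klDiv_eq_tsum_klTerm]
  simp [PMF.toMeasure_apply_singleton]

/-- A family of discrete laws, as a kernel. -/
noncomputable def pmfKernel {α β : Type*} [MeasurableSpace α] [DiscreteMeasurableSpace α]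
    [MeasurableSpace β] (f : α → PMF β) : Kernel α β where
  toFun a := (f a).toMeasure
  measurable' := .of_discrete

instance {α β : Type*} [MeasurableSpace α] [DiscreteMeasurableSpace α] [MeasurableSpace β]
    (f : α → PMF β) : IsMarkovKernel (pmfKernel f) :=
  ⟨fun a => by rw [pmfKernel, Kernel.coe_mk]; infer_instance⟩

theorem pmfKernel_comp {α β : Type*} [Countable α] [MeasurableSpace α] [DiscreteMeasurableSpace α]
    [MeasurableSpace β] (p : PMF α) (f : α → PMF β) :
    pmfKernel f ∘ₘ p.toMeasure = (p.bind f).toMeasure := by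
  ext s hs
  rw [Measure.bind_apply hs (Kernel.aemeasurable _), lintegral_countable',
    PMF.toMeasure_bind_apply _ _ _ hs]
  refine tsum_congr fun a => ?_
  rw [PMF.toMeasure_apply_singleton _ _ (.singleton _), mul_comm]
  rfl

/-- Chain rule for the joint laws, followed by forgetting the first coordinate. With `p = q` it is
joint convexity of the divergence. -/
theorem discreteKL_bind_le {α β : Type*} [Countable α] [Countable β] (p q : PMF α)
    (f g : α → PMF β) :
    discreteKL (p.bind f) (q.bind g) ≤ discreteKL p q + ∑' a, p a * discreteKL (f a) (g a) := by
  let _ : MeasurableSpace α := ⊤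
  let _ : MeasurableSpace β := ⊤
  rw [discreteKL, ← pmfKernel_comp, ← pmfKernel_comp, ← Measure.snd_compProd,
    ← Measure.snd_compProd]
  refine (klDiv_map_le _ _ measurable_snd).trans ?_
  rw [klDiv_compProd_eq_add, klDiv_compProd_eq_tsum]
  refine add_le_add le_rfl (ENNReal.tsum_le_tsum fun a => ?_)
  rw [PMF.toMeasure_apply_singleton _ _ (.singleton _)]
  rfl

theorem discreteKL_bind_le_of_forall {α β : Type*} [Countable α] [Countable β] (p q : PMF α)
    (f g : α → PMF β) {c : ℝ≥0∞} (h : ∀ a, p a ≠ 0 → discreteKL (f a) (g a) ≤ c) :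
    discreteKL (p.bind f) (q.bind g) ≤ discreteKL p q + c := by
  refine (discreteKL_bind_le p q f g).trans (add_le_add le_rfl ?_)
  calc ∑' a, p a * discreteKL (f a) (g a) ≤ ∑' a, p a * c := ENNReal.tsum_le_tsum fun a => by
        by_cases ha : p a = 0
        · simp [ha]
        · gcongr; exact h a ha
    _ = c := by rw [ENNReal.tsum_mul_right, p.tsum_coe, one_mul]

theorem discreteKL_map_le {α β : Type*} [Countable α] [Countable β] (p q : PMF α) (f : α → β) :
    discreteKL (p.map f) (q.map f) ≤ discreteKL p q := by
  simpa [PMF.map] using discreteKL_bind_le_of_forall p q (PMF.pure ∘ f) (PMF.pure ∘ f) (c := 0)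
    (by simp)

theorem discreteKL_eq_ofReal {α : Type*} [Countable α] (p q : PMF α)
    (hac : ∀ x, q x = 0 → p x = 0) {F : α → ℝ} {s : ℝ}
    (hF : ∀ x, p x ≠ 0 → F x = Real.log ((p x).toReal / (q x).toReal))
    (hs : HasSum (fun x => (p x).toReal * F x) s) :
    discreteKL p q = ENNReal.ofReal s := by
  have hsum : ∀ r : PMF α, HasSum (fun x => (r x).toReal) 1 := fun r => by
    have h := ENNReal.hasSum_toReal (f := r) (by simp [r.tsum_coe])
    rwa [← ENNReal.tsum_toReal_eq r.apply_ne_top, r.tsum_coe, ENNReal.toReal_one] at h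
  -- The terms `p log (p/q)` may be negative. The corrections `- p + q` sum to zero and turn each
  -- into the nonnegative `q * klFun (p/q)`, as `ENNReal.ofReal` of a sum requires.
  have hs' := (hs.sub (hsum p)).add (hsum q)
  rw [sub_add_cancel] at hs'
  have key : ∀ x, 0 ≤ (p x).toReal * F x - (p x).toReal + (q x).toReal ∧
      klTerm (p x) (q x) =
        ENNReal.ofReal ((p x).toReal * F x - (p x).toReal + (q x).toReal) := fun x => by
    by_cases hq : q x = 0
    · simp [klTerm, hq, hac x hq]
    have hq' : 0 < (q x).toReal := ENNReal.toReal_pos hq (q.apply_ne_top x)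
    have e : (p x).toReal * F x - (p x).toReal + (q x).toReal =
        (q x).toReal * klFun ((p x).toReal / (q x).toReal) := by
      rw [klFun_apply]
      by_cases hp : p x = 0
      · simp [hp]
      · rw [hF x hp]; field_simp; ring
    rw [e]
    refine ⟨mul_nonneg hq'.le (klFun_nonneg (by positivity)), ?_⟩
    rw [klTerm, if_neg hq, ENNReal.ofReal_mul hq'.le, ENNReal.ofReal_toReal (q.apply_ne_top x),
      ENNReal.toReal_div]
  rw [discreteKL_eq_tsum, tsum_congr fun x => (key x).2,
    ← ENNReal.ofReal_tsum_of_nonneg (fun x => (key x).1) hs'.summable, hs'.tsum_eq]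

theorem discreteKL_pure {α : Type*} [Countable α] (a : α) (q : PMF α) (h : q a ≠ 0) :
    discreteKL (PMF.pure a) q = ENNReal.ofReal (-Real.log (q a).toReal) := by
  classical
  refine discreteKL_eq_ofReal (F := fun _ => -Real.log (q a).toReal) _ _ (fun x hx => ?_)
    (fun x hx => ?_) ?_
  · rw [PMF.pure_apply, if_neg]
    rintro rfl
    exact h hx
  · obtain rfl : x = a := by
      by_contra hxa
      simp [hxa] at hx
    simp
  · convert hasSum_single (f := fun x => ((PMF.pure a) x).toReal * -Real.log (q a).toReal) a
      (fun x hx => by simp [hx]) using 1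
    simp

/-- The mutual information is at most the largest divergence from any fixed output law. -/
theorem mutualInfo_le_of_forall {α β : Type*} [Countable α] [Countable β] (P : PMF α)
    (W : α → PMF β) (Q : PMF β) {c : ℝ≥0∞} (h : ∀ a, discreteKL (W a) Q ≤ c) :
    mutualInfo P W ≤ c := by
  let _ : MeasurableSpace α := ⊤
  let _ : MeasurableSpace β := ⊤
  have h1 := tsum_klDiv_comp_le P.toMeasure (pmfKernel W) Q.toMeasure
  rw [pmfKernel_comp] at h1
  simp only [PMF.toMeasure_apply_singleton _ _ (MeasurableSet.singleton _)] at h1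
  refine le_trans h1 ?_
  calc ∑' a, P a * klDiv (pmfKernel W a) Q.toMeasure ≤ ∑' a, P a * c :=
        ENNReal.tsum_le_tsum fun a => by gcongr; exact h a
    _ = c := by rw [ENNReal.tsum_mul_right, P.tsum_coe, one_mul]

end Divergence

/-! ### The Poisson-repeat channel measured against a source of runs. -/

section Coding

theorem poissonLaw_apply (r : NNReal) (n : ℕ) :
    poissonLaw r n = ENNReal.ofReal (Real.exp (-r) * r ^ n / n.factorial) := by
  rw [poissonLaw, MeasureTheory.Measure.toPMF_apply, ProbabilityTheory.poissonMeasure_singleton]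

theorem poissonLaw_toReal (r : NNReal) (n : ℕ) :
    (poissonLaw r n).toReal = Real.exp (-r) * r ^ n / n.factorial := by
  rw [poissonLaw_apply, ENNReal.toReal_ofReal (by positivity)]

theorem poissonLaw_zero : poissonLaw 0 = PMF.pure 0 := by
  ext n
  rcases n with _ | n <;> simp [poissonLaw_apply]

theorem poissonLaw_bind_add (r s : NNReal) {β : Type*} (f : ℕ → PMF β) :
    (poissonLaw r).bind (fun k => (poissonLaw s).bind fun l => f (k + l)) =
      (poissonLaw (r + s)).bind f := by
  have h : (poissonLaw r).bind (fun k => (poissonLaw s).map fun l => k + l) =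
      poissonLaw (r + s) := by
    rw [← PMF.toMeasure_inj]
    ext t ht
    rw [PMF.toMeasure_bind_apply _ _ _ ht, poissonLaw, poissonLaw, poissonLaw,
      MeasureTheory.Measure.toPMF_toMeasure,
      ← ProbabilityTheory.poissonMeasure_conv_poissonMeasure, ← MeasureTheory.lintegral_indicator_one ht,
      MeasureTheory.Measure.lintegral_conv (by fun_prop), MeasureTheory.lintegral_countable']
    refine tsum_congr fun k => ?_
    rw [MeasureTheory.Measure.toPMF_apply, PMF.toMeasure_map_apply _ _ _ .of_discrete ht,
      MeasureTheory.Measure.toPMF_toMeasure, mul_comm,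
      ← MeasureTheory.lintegral_indicator_one .of_discrete]
    rfl
  rw [← h, PMF.bind_bind]
  congr 1
  funext k
  rw [PMF.bind_map]
  rfl

/-- The law of the output when `r` is the mean number of copies of `b` still to be emitted before
the output of the channel with input `w`. -/
noncomputable def pendingOutput (D : PMF ℕ) (r : NNReal) (b : Bool) (w : List Bool) :
    PMF (List Bool) :=
  (poissonLaw r).bind fun k => (repeatChannel D w).map fun v => List.replicate k b ++ v

theorem pendingOutput_zero (D : PMF ℕ) (b : Bool) (w : List Bool) :
    pendingOutput D 0 b w = repeatChannel D w := by
  rw [pendingOutput, poissonLaw_zero, PMF.pure_bind]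
  simp only [List.replicate_zero, List.nil_append]
  exact PMF.map_id _

theorem pendingOutput_cons_same (r s : NNReal) (b : Bool) (w : List Bool) :
    pendingOutput (poissonLaw s) r b (b :: w) = pendingOutput (poissonLaw s) (r + s) b w := by
  rw [pendingOutput, pendingOutput, ← poissonLaw_bind_add]
  congr 1
  funext k
  rw [repeatChannel, PMF.map_bind]
  congr 1
  funext l
  rw [PMF.map_comp]
  congr 1
  funext v
  rw [List.replicate_add, List.append_assoc]
  rfl

theorem pendingOutput_cons (D : PMF ℕ) (r : NNReal) (b c : Bool) (w : List Bool) :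
    pendingOutput D r b (c :: w) = D.bind fun l => (poissonLaw r).bind fun k =>
      (repeatChannel D w).map fun v => List.replicate k b ++ (List.replicate l c ++ v) := by
  rw [pendingOutput, PMF.bind_comm]
  congr 1
  funext k
  rw [repeatChannel, PMF.map_bind]
  congr 1
  funext l
  rw [PMF.map_comp]
  rfl

/-- `D` conditioned on being positive. -/
noncomputable def conditionPos (D : PMF ℕ) (h : ∃ k ∈ {k : ℕ | k ≠ 0}, k ∈ D.support) : PMF ℕ :=
  D.filter {k | k ≠ 0} h

/-- The coin showing whether `D` is positive. -/
noncomputable def posCoin (D : PMF ℕ) : PMF Bool :=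
  PMF.ofFintype (fun c => if c then 1 - D 0 else D 0) (by
    simp [tsub_add_cancel_of_le (D.coe_le_one 0)])

/-- Separates deletion of a bit from survival, so that convexity can average the two costs. -/
theorem posCoin_bind (D : PMF ℕ) (h : ∃ k ∈ {k : ℕ | k ≠ 0}, k ∈ D.support) {β : Type*}
    (f : ℕ → PMF β) :
    D.bind f = (posCoin D).bind fun c => if c then (conditionPos D h).bind f else f 0 := by
  have hsplit : ∀ g : ℕ → ℝ≥0∞, ∑' k, D k * g k =
      D 0 * g 0 + ∑' k, ({k : ℕ | k ≠ 0}.indicator D k) * g k := fun g => by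
    rw [tsum_eq_zero_add' ENNReal.summable, tsum_eq_zero_add' ENNReal.summable
      (f := fun k => ({k : ℕ | k ≠ 0}.indicator D k) * g k)]
    simp
  have hmass : ∑' k, {k : ℕ | k ≠ 0}.indicator D k = 1 - D 0 := by
    have h1 := hsplit 1
    simp only [Pi.one_apply, mul_one, D.tsum_coe] at h1
    rw [h1, ENNReal.add_sub_cancel_left (D.apply_ne_top 0)]
  obtain ⟨k, hk, hk'⟩ := h
  have hne : 1 - D 0 ≠ 0 := by
    rw [← hmass]
    intro h0
    rw [ENNReal.tsum_eq_zero] at h0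
    exact hk' (by simpa [Set.indicator_of_mem hk] using h0 k)
  ext y
  rw [PMF.bind_apply, PMF.bind_apply, tsum_bool, hsplit]
  simp only [posCoin, PMF.ofFintype_apply, Bool.false_eq_true, if_false, if_true]
  congr 1
  rw [PMF.bind_apply, ← ENNReal.tsum_mul_left]
  refine tsum_congr fun k => ?_
  rw [conditionPos, PMF.filter_apply, hmass, ← mul_assoc]
  congr 1
  rw [mul_comm, mul_assoc, ENNReal.inv_mul_cancel hne (by simp), mul_one]

/-- The coin that shows `false` with probability `1 / (m + 2)`. -/
noncomputable def stopCoin (m : ℕ) : PMF Bool :=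
  PMF.ofFintype (fun c => if c then ENNReal.ofReal ((m + 1) / (m + 2))
    else ENNReal.ofReal (1 / (m + 2))) (by
    simp only [Fintype.sum_bool, if_true, Bool.false_eq_true, if_false]
    rw [← ENNReal.ofReal_add (by positivity) (by positivity), ← add_div,
      show (m : ℝ) + 1 + 1 = m + 2 by ring, div_self (by positivity), ENNReal.ofReal_one])

/-- Words with at most `m + 1` runs, starting with the (possibly empty) run of `b` of length `Y`;
the other runs have the length of the sum of independent copies of `Y` and `D'`. -/
noncomputable def runSource (Y D' : PMF ℕ) : ℕ → Bool → PMF (List Bool)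
  | 0, b => Y.map fun k => List.replicate k b
  | m + 1, b => (stopCoin m).bind fun c =>
      if c then D'.bind fun l => Y.bind fun k => (runSource Y D' m !b).map fun v =>
        List.replicate k b ++ (List.replicate l (!b) ++ v)
      else Y.map fun k => List.replicate k b

/-- A mixture is as good a reference as its component `a`, up to the code length `-log (q a)`:
compare `PMF.pure a` with `q` as mixing laws. -/
theorem discreteKL_bind_right_le {α β : Type*} [Countable α] [Countable β] (p : PMF β) (q : PMF α)
    (g : α → PMF β) (a : α) (ha : q a ≠ 0) :
    discreteKL p (q.bind g) ≤
      ENNReal.ofReal (-Real.log (q a).toReal) + discreteKL p (g a) := by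
  have h := discreteKL_bind_le_of_forall (PMF.pure a) q (fun _ => p) g
    (c := discreteKL p (g a)) fun a' ha' => by
      obtain rfl : a' = a := by
        by_contra hne
        simp [hne] at ha'
      exact le_rfl
  rwa [PMF.pure_bind, discreteKL_pure a q ha] at h

/-- The coins make the number of further runs uniform on `0, …, m`. Thus stopping at level `m` costs
`log (m + 1)`, and the costs of continuing telescope: the total does not depend on where the word
stops. -/
theorem discreteKL_runSource_stop (Y D' : PMF ℕ) (m : ℕ) (b : Bool) (p : PMF (List Bool)) :
    discreteKL p (runSource Y D' m b) ≤ ENNReal.ofReal (Real.log (m + 1)) +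
      discreteKL p (Y.map fun k => List.replicate k b) := by
  rcases m with _ | m
  · simp [runSource]
  · have h : (0 : ℝ) < 1 / (m + 2) := by positivity
    refine (discreteKL_bind_right_le p (stopCoin m) _ false ?_).trans (le_of_eq ?_)
    · simpa [stopCoin] using h
    · simp only [stopCoin, PMF.ofFintype_apply, Bool.false_eq_true, if_false]
      rw [ENNReal.toReal_ofReal h.le, one_div, Real.log_inv, neg_neg]
      push_cast
      ring_nf

theorem discreteKL_runSource_continue (Y D' : PMF ℕ) (m : ℕ) (b : Bool) (p : PMF (List Bool)) :
    discreteKL p (runSource Y D' (m + 1) b) ≤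
      ENNReal.ofReal (Real.log (m + 2) - Real.log (m + 1)) +
      discreteKL p (D'.bind fun l => Y.bind fun k => (runSource Y D' m !b).map fun v =>
        List.replicate k b ++ (List.replicate l (!b) ++ v)) := by
  have h : (0 : ℝ) < (m + 1) / (m + 2) := by positivity
  refine (discreteKL_bind_right_le p (stopCoin m) _ true ?_).trans (le_of_eq ?_)
  · simpa [stopCoin] using h
  · simp only [stopCoin, PMF.ofFintype_apply, if_true]
    rw [ENNReal.toReal_ofReal h.le, Real.log_div (by positivity) (by positivity), neg_sub]

theorem conditionPos_poissonLaw {s : NNReal} (hs : 0 < s) :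
    ∃ k ∈ {k : ℕ | k ≠ 0}, k ∈ (poissonLaw s).support := by
  refine ⟨1, one_ne_zero, ?_⟩
  rw [PMF.mem_support_iff, poissonLaw_apply, ne_eq, ENNReal.ofReal_eq_zero, not_le]
  have : (0 : ℝ) < s := hs
  positivity

/-- If the divergence of every Poisson law from `Y` is at most affine in its mean, the divergence
of every output of the Poisson-repeat channel from the run source is affine in the input length. -/
theorem discreteKL_pendingOutput_le {s : NNReal} (hs : 0 < s) (Y : PMF ℕ) {A B C : ℝ}
    (hA : 0 ≤ A) (hB : 0 ≤ B) (hAC : A * s = C) (hBC : (1 - Real.exp (-s)) * B = C)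
    (hY : ∀ x : NNReal, discreteKL (poissonLaw x) Y ≤ ENNReal.ofReal (B + A * x))
    (w : List Bool) : ∀ (m : ℕ) (b : Bool) (r : NNReal), w.length ≤ m →
    discreteKL (pendingOutput (poissonLaw s) r b w)
      (runSource Y (conditionPos (poissonLaw s) (conditionPos_poissonLaw hs)) m b) ≤
      ENNReal.ofReal (B + A * r + C * w.length + Real.log (m + 1)) := by
  have hC : 0 ≤ C := by rw [← hAC]; positivity
  have hlog : ∀ m : ℕ, 0 ≤ Real.log ((m : ℝ) + 1) := fun m => Real.log_nonneg (by simp)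
  induction w with
  | nil =>
    intro m b r _
    have h : pendingOutput (poissonLaw s) r b [] =
        (poissonLaw r).map fun k => List.replicate k b := by
      simp [pendingOutput, repeatChannel, PMF.map, Function.comp_def]
    refine (discreteKL_runSource_stop _ _ _ _ _).trans ?_
    rw [h]
    calc _ ≤ ENNReal.ofReal (Real.log (m + 1)) + ENNReal.ofReal (B + A * r) := by
          gcongr
          exact (discreteKL_map_le _ _ _).trans (hY r)
      _ = _ := by
          rw [← ENNReal.ofReal_add (hlog m) (by positivity)]
          congr 1
          simp
          ring
  | cons c w ih =>
    intro m b r hm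
    rw [List.length_cons] at hm
    -- An equal bit merges into the pending run by additivity of Poisson laws: `r` becomes `r + s`,
    -- and `A * s = C`.
    by_cases hcb : c = b
    · subst hcb
      rw [pendingOutput_cons_same]
      refine (ih m c (r + s) (by omega)).trans (ENNReal.ofReal_le_ofReal (le_of_eq ?_))
      rw [List.length_cons, ← hAC]
      push_cast
      ring
    obtain rfl : c = !b := by cases b <;> cases c <;> simp_all
    obtain ⟨m, rfl⟩ : ∃ k, m = k + 1 := ⟨m - 1, by omega⟩
    set G := runSource Y (conditionPos (poissonLaw s) (conditionPos_poissonLaw hs)) (m + 1) b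
      with hG
    -- The different bit is deleted: the run of `b` stays pending and no run of the budget is used.
    have hdel : discreteKL (pendingOutput (poissonLaw s) r b w) G ≤
        ENNReal.ofReal (B + A * r + C * w.length + Real.log (m + 2)) := by
      refine (ih (m + 1) b r (by omega)).trans (le_of_eq ?_)
      push_cast
      ring_nf
    -- The different bit survives: closing the run of `b` costs `B + A * r`, the positive length `l`
    -- is matched at no cost, and the next run starts with pending mean `0`. The excess over
    -- deletion is exactly `B`.
    have hsur : discreteKL ((conditionPos (poissonLaw s) (conditionPos_poissonLaw hs)).bind
          fun l => (poissonLaw r).bind fun k => (repeatChannel (poissonLaw s) w).map fun v =>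
            List.replicate k b ++ (List.replicate l (!b) ++ v)) G ≤
        ENNReal.ofReal (B + A * r + C * w.length + Real.log (m + 2) + B) := by
      refine (discreteKL_runSource_continue _ _ _ _ _).trans ?_
      have h1 : discreteKL (repeatChannel (poissonLaw s) w)
          (runSource Y (conditionPos (poissonLaw s) (conditionPos_poissonLaw hs)) m !b) ≤
          ENNReal.ofReal (B + C * w.length + Real.log (m + 1)) := by
        have := ih m (!b) 0 (by omega)
        rw [pendingOutput_zero] at this
        simpa using this
      have h2 := discreteKL_bind_le_of_forall
        (conditionPos (poissonLaw s) (conditionPos_poissonLaw hs))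
        (conditionPos (poissonLaw s) (conditionPos_poissonLaw hs))
        (fun l => (poissonLaw r).bind fun k => (repeatChannel (poissonLaw s) w).map fun v =>
            List.replicate k b ++ (List.replicate l (!b) ++ v))
        (fun l => Y.bind fun k => (runSource Y
          (conditionPos (poissonLaw s) (conditionPos_poissonLaw hs)) m !b).map fun v =>
            List.replicate k b ++ (List.replicate l (!b) ++ v))
        (c := ENNReal.ofReal (B + A * r) + ENNReal.ofReal (B + C * w.length + Real.log (m + 1)))
        fun l _ => (discreteKL_bind_le_of_forall _ _ _ _
          (fun k _ => (discreteKL_map_le _ _ _).trans h1)).trans (by gcongr; exact hY r)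
      rw [discreteKL_self, zero_add] at h2
      refine (add_le_add le_rfl h2).trans (le_of_eq ?_)
      have h3 : 0 ≤ Real.log ((m : ℝ) + 2) - Real.log (m + 1) :=
        sub_nonneg.2 (Real.log_le_log (by positivity) (by linarith))
      have h4 := hlog m
      rw [← ENNReal.ofReal_add (by positivity) (by positivity),
        ← ENNReal.ofReal_add h3 (by positivity)]
      congr 1
      ring
    rw [pendingOutput_cons, posCoin_bind _ (conditionPos_poissonLaw hs)]
    -- Convexity averages the two cases against the same reference `G`; the excess becomes `(1 - exp
    -- (-s)) * B = C`.
    have h0 := discreteKL_bind_le (posCoin (poissonLaw s)) (posCoin (poissonLaw s))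
      (fun c => if c then (conditionPos (poissonLaw s) (conditionPos_poissonLaw hs)).bind
          fun l => (poissonLaw r).bind fun k => (repeatChannel (poissonLaw s) w).map fun v =>
            List.replicate k b ++ (List.replicate l (!b) ++ v)
        else (poissonLaw r).bind fun k => (repeatChannel (poissonLaw s) w).map fun v =>
            List.replicate k b ++ (List.replicate 0 (!b) ++ v)) (fun _ => G)
    rw [PMF.bind_const, discreteKL_self, zero_add, tsum_bool] at h0
    refine h0.trans ?_
    have hp0 : poissonLaw s 0 = ENNReal.ofReal (Real.exp (-s)) := by simp [poissonLaw_apply]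
    have hp1 : 1 - poissonLaw s 0 = ENNReal.ofReal (1 - Real.exp (-s)) := by
      rw [hp0, ENNReal.ofReal_sub _ (Real.exp_pos _).le, ENNReal.ofReal_one]
    have hexp : 0 ≤ 1 - Real.exp (-s) := by
      rw [sub_nonneg, Real.exp_le_one_iff]; simp
    have hlog2 : 0 ≤ Real.log ((m : ℝ) + 2) := Real.log_nonneg (by linarith [m.cast_nonneg (α := ℝ)])
    simp only [posCoin, PMF.ofFintype_apply, Bool.false_eq_true, if_false, if_true, hp1]
    calc _ ≤ ENNReal.ofReal (Real.exp (-s)) *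
            ENNReal.ofReal (B + A * r + C * w.length + Real.log (m + 2)) +
          ENNReal.ofReal (1 - Real.exp (-s)) *
            ENNReal.ofReal (B + A * r + C * w.length + Real.log (m + 2) + B) := by
          rw [hp0]
          gcongr
          simpa only [List.replicate_zero, List.nil_append] using! hdel
      _ = _ := by
          rw [← ENNReal.ofReal_mul (Real.exp_pos _).le, ← ENNReal.ofReal_mul hexp,
            ← ENNReal.ofReal_add (by positivity) (by positivity)]
          congr 1
          rw [List.length_cons]
          push_cast
          rw [show (m : ℝ) + 1 + 1 = m + 2 by ring]
          linear_combination hBC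

theorem poissonRepeatCapacity_le {d : ℝ} (hd0 : 0 < d) (hd1 : d < 1) (Y : PMF ℕ) {A B C : ℝ}
    (hA : 0 ≤ A) (hB : 0 ≤ B) (hAC : A * -Real.log d = C) (hBC : (1 - d) * B = C)
    (hY : ∀ x : NNReal, discreteKL (poissonLaw x) Y ≤ ENNReal.ofReal (B + A * x)) :
    poissonRepeatCapacity d ≤ ENNReal.ofReal C := by
  have hlogd : Real.log (1 / d) = -Real.log d := by rw [one_div, Real.log_inv]
  have hpos : 0 < -Real.log d := neg_pos.2 (Real.log_neg hd0 hd1)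
  set s : NNReal := (Real.log (1 / d)).toNNReal with hs
  have hsr : (s : ℝ) = -Real.log d := by
    rw [hs, hlogd, Real.coe_toNNReal _ hpos.le]
  have hs0 : 0 < s := by rw [← NNReal.coe_pos, hsr]; exact hpos
  have hC : 0 ≤ C := by rw [← hAC]; positivity
  have hexp : Real.exp (-s) = d := by rw [hsr, neg_neg, Real.exp_log hd0]
  have hbound : ∀ n : ℕ, (⨆ P : PMF (Fin n → Bool),
      mutualInfo P fun x => repeatChannel (poissonLaw s) (List.ofFn x)) / (n : ℝ≥0∞) ≤
      ENNReal.ofReal (B + C * n + Real.log (n + 1)) / n := fun n => by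
    gcongr
    refine iSup_le fun P => mutualInfo_le_of_forall P _
      (runSource Y (conditionPos (poissonLaw s) (conditionPos_poissonLaw hs0)) n true) fun x => ?_
    have := discreteKL_pendingOutput_le hs0 Y hA hB (by rw [hsr, hAC]) (by rw [hexp, hBC]) hY
      (List.ofFn x) n true 0 (by simp)
    rw [pendingOutput_zero] at this
    simpa using this
  have hlim : Filter.Tendsto (fun n : ℕ => ENNReal.ofReal (B + C * n + Real.log (n + 1)) / n)
      Filter.atTop (nhds (ENNReal.ofReal C)) := by
    have h1 : Filter.Tendsto (fun n : ℕ => B / n + C + Real.log ((n : ℝ) + 1) / n)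
        Filter.atTop (nhds C) := by
      have h2 : Filter.Tendsto (fun n : ℕ => Real.log ((n : ℝ) + 1) / n)
          Filter.atTop (nhds 0) := by
        -- `log (n+1) / n` is `log (n+1) / (n+1)` times `1 + 1/n`.
        have h3 := ((Real.isLittleO_log_id_atTop.tendsto_div_nhds_zero).comp
          (Filter.tendsto_atTop_add_const_right _ (1 : ℝ) tendsto_natCast_atTop_atTop)).mul
          ((tendsto_const_div_atTop_nhds_zero_nat (1 : ℝ)).const_add 1)
        rw [zero_mul] at h3
        refine h3.congr' ?_
        filter_upwards [Filter.eventually_gt_atTop 0] with n hn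
        have hn' : (0 : ℝ) < n := by exact_mod_cast hn
        simp only [Function.comp_apply, id]
        field_simp
      simpa using ((tendsto_const_div_atTop_nhds_zero_nat B).add_const C).add h2
    refine ((ENNReal.continuous_ofReal.tendsto C).comp h1).congr' ?_
    filter_upwards [Filter.eventually_gt_atTop 0] with n hn
    have hn' : (0 : ℝ) < n := by exact_mod_cast hn
    rw [Function.comp_apply, ← ENNReal.ofReal_natCast n, ← ENNReal.ofReal_div_of_pos hn']
    congr 1
    field_simp
  exact (Filter.limsup_le_limsup (Filter.Eventually.of_forall hbound)).trans hlim.limsup_eq.le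

end Coding

/-! ### Poisson expectations and Jensen's inequality for `t log t`. -/

section PoissonExpectation

/-- The mass function of the Poisson law with mean `x`. -/
noncomputable def poissonWeight (x : ℝ) (y : ℕ) : ℝ := Real.exp (-x) * x ^ y / y.factorial

theorem poissonWeight_nonneg {x : ℝ} (hx : 0 ≤ x) (y : ℕ) : 0 ≤ poissonWeight x y := by
  unfold poissonWeight; positivity

theorem hasSum_pow_div_factorial (x : ℝ) :
    HasSum (fun y : ℕ => x ^ y / y.factorial) (Real.exp x) := by
  have h := NormedSpace.expSeries_div_hasSum_exp (𝔸 := ℝ) x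
  rwa [← Real.exp_eq_exp_ℝ] at h

theorem hasSum_poissonWeight (x : ℝ) : HasSum (poissonWeight x) 1 := by
  have h := (hasSum_pow_div_factorial x).mul_left (Real.exp (-x))
  rw [← Real.exp_add, neg_add_cancel, Real.exp_zero] at h
  refine h.congr_fun fun y => ?_
  rw [poissonWeight, mul_div_assoc]

/-- `𝔼[Y f(Y)] = x 𝔼[f(Y + 1)]` for a Poisson variable `Y` with mean `x`. -/
theorem HasSum.poissonWeight_mul {x s : ℝ} {f : ℕ → ℝ}
    (h : HasSum (fun y => poissonWeight x y * f (y + 1)) s) :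
    HasSum (fun y : ℕ => poissonWeight x y * (y * f y)) (x * s) := by
  rw [← hasSum_nat_add_iff' 1]
  simp only [Finset.range_one, Finset.sum_singleton, Nat.cast_zero, zero_mul, mul_zero, sub_zero]
  refine (h.mul_left x).congr_fun fun y => ?_
  simp only [poissonWeight, Nat.factorial_succ]
  push_cast
  field_simp
  ring

theorem hasSum_poissonWeight_mul_self (x : ℝ) :
    HasSum (fun y : ℕ => poissonWeight x y * y) x := by
  have h := HasSum.poissonWeight_mul (x := x) (s := 1) (f := fun _ => 1)
    ((hasSum_poissonWeight x).congr_fun fun y => by rw [mul_one])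
  rw [mul_one] at h
  exact h.congr_fun fun y => by rw [mul_one]

theorem summable_poissonWeight_mul_sq (x : ℝ) :
    Summable (fun y : ℕ => poissonWeight x y * ((y : ℝ) * y)) := by
  have h : HasSum (fun y => poissonWeight x y * (fun z : ℕ => (z : ℝ)) (y + 1)) (x + 1) := by
    refine ((hasSum_poissonWeight_mul_self x).add (hasSum_poissonWeight x)).congr_fun fun y => ?_
    push_cast
    ring
  exact h.poissonWeight_mul.summable

theorem summable_poissonWeight_mul_of_abs_le {x : ℝ} (hx : 0 ≤ x) {f : ℕ → ℝ} {c : ℝ}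
    (hf : ∀ y : ℕ, |f y| ≤ c * (y * y + 1)) : Summable (fun y => poissonWeight x y * f y) := by
  refine Summable.of_norm_bounded (((summable_poissonWeight_mul_sq x).add
    (hasSum_poissonWeight x).summable).mul_left c) fun y => ?_
  rw [norm_mul, Real.norm_of_nonneg (poissonWeight_nonneg hx y), Real.norm_eq_abs]
  calc _ ≤ poissonWeight x y * (c * (y * y + 1)) :=
        mul_le_mul_of_nonneg_left (hf y) (poissonWeight_nonneg hx y)
    _ = _ := by ring

theorem natCast_mul_log_nonneg (y : ℕ) : 0 ≤ (y : ℝ) * Real.log y :=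
  mul_nonneg y.cast_nonneg (Real.log_natCast_nonneg y)

theorem natCast_mul_log_le (y : ℕ) : (y : ℝ) * Real.log y ≤ y * y :=
  mul_le_mul_of_nonneg_left (Real.log_le_self y.cast_nonneg) y.cast_nonneg

theorem summable_poissonWeight_mul_log {x : ℝ} (hx : 0 ≤ x) :
    Summable (fun y : ℕ => poissonWeight x y * (y * Real.log y)) := by
  refine summable_poissonWeight_mul_of_abs_le hx (c := 1) fun y => ?_
  rw [abs_of_nonneg (natCast_mul_log_nonneg y)]
  linarith [natCast_mul_log_le y]

/-- `𝔼[Y log Y] ≥ x log x` for a Poisson variable `Y` with mean `x`. -/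
theorem mul_log_le_tsum_poissonWeight {x : ℝ} (hx : 0 < x) :
    x * Real.log x ≤ ∑' y : ℕ, poissonWeight x y * (y * Real.log y) := by
  -- `(log x + 1) t - x` is the tangent to `t log t` at `t = x`; its Poisson mean is `x log x`.
  have h := ((hasSum_poissonWeight_mul_self x).mul_left (Real.log x + 1)).sub
    ((hasSum_poissonWeight x).mul_left x)
  have h2 := hasSum_le (fun y => ?_) h (summable_poissonWeight_mul_log hx.le).hasSum
  · linarith
  have hw := poissonWeight_nonneg hx.le y
  have key : (Real.log x + 1) * y - x ≤ y * Real.log y := by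
    rcases Nat.eq_zero_or_pos y with rfl | hy
    · simpa using hx.le
    have hy' : (0 : ℝ) < y := by exact_mod_cast hy
    have h3 := Real.log_le_sub_one_of_pos (div_pos hx hy')
    rw [Real.log_div hx.ne' hy'.ne'] at h3
    have h4 := mul_le_mul_of_nonneg_left h3 hy'.le
    have h5 : (y : ℝ) * (x / y - 1) = x - y := by field_simp
    linarith
  calc _ = poissonWeight x y * ((Real.log x + 1) * y - x) := by ring
    _ ≤ _ := mul_le_mul_of_nonneg_left key hw

end PoissonExpectation

/-! ### Bounds for digamma at integers and its Poisson expectation. -/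

section Digamma

theorem realDigamma_succ (n : ℕ) :
    realDigamma ((n + 1 : ℕ) : ℝ) = (harmonic n : ℝ) - Real.eulerMascheroniConstant := by
  rw [realDigamma]
  push_cast
  rw [Real.deriv_Gamma_nat, Real.Gamma_nat_eq_factorial]
  have : (n.factorial : ℝ) ≠ 0 := by positivity
  field_simp
  ring

theorem tendsto_harmonic_sub_log_add (a : ℝ) :
    Filter.Tendsto (fun n : ℕ => (harmonic n : ℝ) - Real.log (n + a)) Filter.atTop
      (nhds Real.eulerMascheroniConstant) := by
  have h1 : Filter.Tendsto (fun n : ℕ => Real.log (1 + a / n)) Filter.atTop (nhds 0) := by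
    have h2 := (tendsto_const_div_atTop_nhds_zero_nat a).const_add 1
    rw [add_zero] at h2
    simpa using h2.log one_ne_zero
  have h3 := Real.tendsto_harmonic_sub_log.sub h1
  rw [sub_zero] at h3
  refine h3.congr' ?_
  have h4 : Filter.Tendsto (fun n : ℕ => (n : ℝ) + a) Filter.atTop Filter.atTop :=
    Filter.tendsto_atTop_add_const_right _ a tendsto_natCast_atTop_atTop
  filter_upwards [Filter.eventually_gt_atTop 0, h4.eventually_gt_atTop 0] with n hn hn2
  have hn' : (0 : ℝ) < n := by exact_mod_cast hn
  rw [show 1 + a / n = (n + a) / n by field_simp, Real.log_div hn2.ne' hn'.ne']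
  ring

theorem harmonic_succ_real (n : ℕ) : (harmonic (n + 1) : ℝ) = harmonic n + 1 / (n + 1) := by
  rw [harmonic_succ]; push_cast; rw [one_div]

/-- `H_n - log (n + 1/2)` decreases to `γ`: the bound `log (1 + u) ≥ 2u / (u + 2)` at `u = 1 / (n +
1/2)` gives precisely `1 / (n + 1)`. -/
theorem log_add_half_le_realDigamma (n : ℕ) :
    Real.log (n + 1 / 2) ≤ realDigamma ((n + 1 : ℕ) : ℝ) := by
  have hanti : Antitone (fun n : ℕ => (harmonic n : ℝ) - Real.log (n + 1 / 2)) := by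
    refine antitone_nat_of_succ_le fun n => ?_
    have h1 := Real.le_log_one_add_of_nonneg (x := 1 / ((n : ℝ) + 1 / 2)) (by positivity)
    have h2 : 2 * (1 / ((n : ℝ) + 1 / 2)) / (1 / ((n : ℝ) + 1 / 2) + 2) = 1 / (n + 1) := by
      field_simp; ring
    have h3 : 1 + 1 / ((n : ℝ) + 1 / 2) = (n + 1 + 1 / 2) / (n + 1 / 2) := by field_simp; ring
    rw [h2, h3, Real.log_div (by positivity) (by positivity)] at h1
    rw [harmonic_succ_real]
    push_cast
    linarith
  have := hanti.le_of_tendsto (tendsto_harmonic_sub_log_add (1 / 2)) n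
  rw [realDigamma_succ]
  linarith

theorem log_le_half_sub_inv {t : ℝ} (ht : 1 ≤ t) : Real.log t ≤ (t - t⁻¹) / 2 := by
  have h := Real.self_le_sinh_iff.2 (Real.log_nonneg ht)
  rwa [Real.sinh_eq, Real.exp_neg, Real.exp_log (by linarith)] at h

/-- `H_n - log (n+1) + 1 / (2(n+1))` increases to `γ`: at `t = (n+2)/(n+1)`, `(t - 1/t)/2` is the
average of `1/(n+1)` and `1/(n+2)`. -/
theorem realDigamma_le_log_sub (n : ℕ) :
    realDigamma ((n + 1 : ℕ) : ℝ) ≤ Real.log (n + 1) - 1 / (2 * (n + 1)) := by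
  have hmono : Monotone (fun n : ℕ =>
      (harmonic n : ℝ) - Real.log (n + 1) + 1 / 2 * (1 / ((n : ℝ) + 1))) := by
    refine monotone_nat_of_le_succ fun n => ?_
    have h1 := log_le_half_sub_inv (t := ((n : ℝ) + 1 + 1) / (n + 1))
      (by rw [le_div_iff₀ (by positivity)]; linarith)
    rw [Real.log_div (by positivity) (by positivity)] at h1
    have h2 : (((n : ℝ) + 1 + 1) / (n + 1) - (((n : ℝ) + 1 + 1) / (n + 1))⁻¹) / 2 =
        1 / 2 * (1 / (n + 1)) + 1 / 2 * (1 / (n + 1 + 1)) := by field_simp; ring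
    rw [h2] at h1
    rw [harmonic_succ_real]
    push_cast
    linarith
  have hlim := (tendsto_harmonic_sub_log_add 1).add
    ((tendsto_one_div_add_atTop_nhds_zero_nat (𝕜 := ℝ)).const_mul (1 / 2))
  rw [mul_zero, add_zero] at hlim
  have := hmono.ge_of_tendsto hlim n
  rw [realDigamma_succ]
  have h3 : 1 / (2 * ((n : ℝ) + 1)) = 1 / 2 * (1 / (n + 1)) := by field_simp
  rw [h3]
  linarith

theorem mul_realDigamma_le (y : ℕ) : (y : ℝ) * realDigamma y ≤ y * Real.log y := by
  rcases y with _ | n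
  · simp
  refine mul_le_mul_of_nonneg_left ?_ (Nat.cast_nonneg _)
  refine (realDigamma_le_log_sub n).trans ?_
  push_cast
  have : 0 ≤ 1 / (2 * ((n : ℝ) + 1)) := by positivity
  linarith

/-- The bounded loss suffices: it is divided by the Poisson mean, which tends to infinity. -/
theorem mul_log_sub_one_le_mul_realDigamma (y : ℕ) :
    (y : ℝ) * Real.log y - 1 ≤ y * realDigamma y := by
  rcases y with _ | n
  · simp
  have h1 := Real.one_sub_inv_le_log_of_pos (x := ((n : ℝ) + 1 / 2) / (n + 1)) (by positivity)
  rw [Real.log_div (by positivity) (by positivity)] at h1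
  have h2 := log_add_half_le_realDigamma n
  have h3 : ((n : ℝ) + 1) * (1 - (((n : ℝ) + 1 / 2) / (n + 1))⁻¹) ≥ -1 := by
    rw [inv_div, ge_iff_le, one_sub_div (by positivity), mul_div_assoc', le_div_iff₀ (by positivity)]
    ring_nf
    linarith [n.cast_nonneg (α := ℝ)]
  have h4 := mul_le_mul_of_nonneg_left (h1.trans (sub_le_sub_right h2 _))
    (by positivity : (0 : ℝ) ≤ n + 1)
  push_cast at *
  linarith

theorem summable_poissonWeight_mul_digamma {x : ℝ} (hx : 0 ≤ x) :
    Summable (fun y : ℕ => poissonWeight x y * (y * realDigamma y)) := by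
  refine summable_poissonWeight_mul_of_abs_le hx (c := 1) fun y => ?_
  rw [abs_le]
  constructor
  · nlinarith [mul_log_sub_one_le_mul_realDigamma y, natCast_mul_log_nonneg y]
  · linarith [mul_realDigamma_le y, natCast_mul_log_le y]

theorem harmonic_nonneg_real (n : ℕ) : (0 : ℝ) ≤ harmonic n := by
  induction n with
  | zero => simp
  | succ n ih => rw [harmonic_succ_real]; positivity

theorem harmonic_le_self_real (n : ℕ) : (harmonic n : ℝ) ≤ n := by
  induction n with
  | zero => simp
  | succ n ih =>
    rw [harmonic_succ_real]
    push_cast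
    have : 1 / ((n : ℝ) + 1) ≤ 1 := by rw [div_le_one (by positivity)]; linarith [n.cast_nonneg (α := ℝ)]
    linarith

theorem summable_harmonic_mul {x : ℝ} (hx : 0 ≤ x) :
    Summable (fun y : ℕ => x ^ y / y.factorial * (harmonic y : ℝ)) := by
  have h := (summable_poissonWeight_mul_of_abs_le hx (c := 1) (f := fun y => (harmonic y : ℝ))
    fun y => ?_).mul_left (Real.exp x)
  · refine h.congr fun y => ?_
    rw [poissonWeight, Real.exp_neg]
    field_simp
  · rw [abs_of_nonneg (harmonic_nonneg_real y)]
    nlinarith [harmonic_le_self_real y, sq_nonneg ((y : ℝ) - 1)]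

/-- The exponential generating function of the harmonic numbers. -/
noncomputable def harmonicExp (x : ℝ) : ℝ := ∑' y : ℕ, x ^ y / y.factorial * (harmonic y : ℝ)

/-- Differentiation shifts `H_n` to `H_n + 1/(n+1)`, and `∑ x^n / (n+1)! = (exp x - 1) / x`. The
differentiated series is dominated on `(-R, R)` by its value at `R`. -/
theorem hasDerivAt_harmonicExp {x : ℝ} (hx : 0 < x) :
    HasDerivAt harmonicExp (harmonicExp x + (Real.exp x - 1) / x) x := by
  set R := x + 1
  have hR : 0 < R := by positivity
  have hder : ∀ z : ℝ, 0 ≤ z → HasSum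
      (fun n : ℕ => (n * z ^ (n - 1)) / n.factorial * (harmonic n : ℝ))
      (∑' n : ℕ, z ^ n / n.factorial * (harmonic (n + 1) : ℝ)) := fun z hz => by
    have hs : Summable fun n : ℕ => z ^ n / n.factorial * (harmonic (n + 1) : ℝ) := by
      refine Summable.of_nonneg_of_le (fun n => mul_nonneg (by positivity)
        (harmonic_nonneg_real _)) (fun n => ?_)
        ((summable_harmonic_mul hz).add (hasSum_pow_div_factorial z).summable)
      rw [harmonic_succ_real, mul_add]
      gcongr
      refine mul_le_of_le_one_right (by positivity) ?_
      rw [div_le_one (by positivity)]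
      linarith [n.cast_nonneg (α := ℝ)]
    rw [← hasSum_nat_add_iff' 1]
    simp only [Finset.range_one, Finset.sum_singleton, Nat.cast_zero, zero_mul, zero_div, sub_zero]
    refine hs.hasSum.congr_fun fun n => ?_
    rw [Nat.factorial_succ, Nat.add_sub_cancel]
    push_cast
    field_simp
  have h := hasDerivAt_tsum_of_isPreconnected (t := Set.Ioo (-R) R) (y₀ := 0) (y := x)
    (g := fun (n : ℕ) z => z ^ n / n.factorial * (harmonic n : ℝ))
    (g' := fun (n : ℕ) z => (n * z ^ (n - 1)) / n.factorial * (harmonic n : ℝ))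
    (hder R hR.le).summable isOpen_Ioo isPreconnected_Ioo
    (fun n z _ => ((hasDerivAt_pow n z).div_const _).mul_const _) (fun n z hz => ?_)
    ⟨by linarith, hR⟩ (summable_harmonic_mul le_rfl) ⟨by linarith, by linarith⟩
  · refine h.congr_deriv ?_
    rw [(hder x hx.le).tsum_eq]
    have h1 : HasSum (fun n : ℕ => x ^ n / n.factorial * (1 / ((n : ℝ) + 1)))
        ((Real.exp x - 1) / x) := by
      have h2 := hasSum_pow_div_factorial x
      rw [← hasSum_nat_add_iff' 1] at h2
      simp only [Finset.range_one, Finset.sum_singleton, pow_zero, Nat.factorial_zero, Nat.cast_one,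
        div_one] at h2
      refine (h2.div_const x).congr_fun fun n => ?_
      rw [Nat.factorial_succ]
      push_cast
      field_simp
      ring
    rw [harmonicExp, ← ((summable_harmonic_mul hx.le).hasSum.add h1).tsum_eq]
    refine tsum_congr fun n => ?_
    rw [harmonic_succ_real, mul_add]
  · rw [Real.norm_eq_abs, abs_mul, abs_div, abs_mul, abs_pow, Nat.abs_cast, Nat.abs_cast,
      abs_of_nonneg (harmonic_nonneg_real n)]
    have h0 := harmonic_nonneg_real n
    have h1 : |z| ≤ R := (abs_lt.2 hz).le
    gcongr

theorem tsum_poissonWeight_mul_digamma (x : ℝ) (hx : 0 ≤ x) :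
    ∑' y : ℕ, poissonWeight x y * (y * realDigamma y) =
      x * (Real.exp (-x) * harmonicExp x - Real.eulerMascheroniConstant) := by
  refine (HasSum.poissonWeight_mul (f := fun y => realDigamma y) ?_).tsum_eq
  have h := ((summable_harmonic_mul hx).hasSum.mul_left (Real.exp (-x))).sub
    ((hasSum_poissonWeight x).mul_right Real.eulerMascheroniConstant)
  rw [one_mul] at h
  refine h.congr_fun fun y => ?_
  rw [realDigamma_succ, poissonWeight]
  ring

/-- `𝔼[Y ψ(Y)] ≥ x log x` for a Poisson variable `Y` with mean `x`. -/
theorem mul_log_le_tsum_poissonWeight_digamma {x : ℝ} (hx : 0 < x) :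
    x * Real.log x ≤ ∑' y : ℕ, poissonWeight x y * (y * realDigamma y) := by
  -- Since `𝔼[Y ψ(Y)] - x log x = x (f x - γ)`, the claim is `f ≥ γ`. The function `f` decreases,
  -- with `f' = -exp (-x) / x`, so a lower bound tending to `γ` at infinity suffices.
  set f : ℝ → ℝ := fun x => Real.exp (-x) * harmonicExp x - Real.log x with hf
  have hderiv : ∀ z : ℝ, 0 < z → HasDerivAt f (-(Real.exp (-z) / z)) z := fun z hz => by
    have h := (((hasDerivAt_neg z).exp).mul (hasDerivAt_harmonicExp hz)).sub
      (Real.hasDerivAt_log hz.ne')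
    refine h.congr_deriv ?_
    have : Real.exp (-z) * Real.exp z = 1 := by rw [← Real.exp_add]; simp
    field_simp
    linear_combination this
  have hanti : AntitoneOn f (Set.Ioi 0) := by
    refine antitoneOn_of_deriv_nonpos (convex_Ioi 0)
      (fun z hz => (hderiv z hz).continuousAt.continuousWithinAt)
      (fun z hz => ?_) (fun z hz => ?_) <;> rw [interior_Ioi] at hz
    · exact (hderiv z hz).differentiableAt.differentiableWithinAt
    · rw [(hderiv z hz).deriv, neg_nonpos]
      exact div_nonneg (Real.exp_pos _).le (le_of_lt hz)
  have hlow : ∀ z : ℝ, 0 < z → Real.eulerMascheroniConstant - 1 / z ≤ f z := fun z hz => by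
    have h1 := mul_log_le_tsum_poissonWeight hz
    have h2 := hasSum_le (fun y => ?_)
      ((summable_poissonWeight_mul_log hz.le).hasSum.sub (hasSum_poissonWeight z))
      (summable_poissonWeight_mul_digamma hz.le).hasSum
    · rw [tsum_poissonWeight_mul_digamma z hz.le] at h2
      have h3 : z * (Real.eulerMascheroniConstant - 1 / z) ≤ z * f z := by
        rw [mul_sub, mul_one_div_cancel hz.ne', hf]
        linarith
      exact le_of_mul_le_mul_left h3 hz
    · nlinarith [mul_log_sub_one_le_mul_realDigamma y, poissonWeight_nonneg hz.le y]
  have hlim : Real.eulerMascheroniConstant ≤ f x := by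
    have h1 : Filter.Tendsto (fun z : ℝ => Real.eulerMascheroniConstant - 1 / z) Filter.atTop
        (nhds (Real.eulerMascheroniConstant - 0)) :=
      (tendsto_const_nhds.div_atTop Filter.tendsto_id).const_sub _
    rw [sub_zero] at h1
    refine le_of_tendsto h1 ?_
    filter_upwards [Filter.eventually_ge_atTop x] with z hz
    have hz0 : 0 < z := hx.trans_le hz
    exact (hlow z hz0).trans (hanti hx hz0 hz)
  rw [tsum_poissonWeight_mul_digamma x hx.le]
  exact mul_le_mul_of_nonneg_left (by rw [hf] at hlim; linarith) hx.le

end Digamma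

/-! ### The common family of weights, and its divergence from Poisson laws. -/

section ExponentialWeights

/-- The weights `exp (g y) (q / e) ^ y / y!`. -/
noncomputable def expWeight (g : ℕ → ℝ) (q : ℝ) (y : ℕ) : ℝ :=
  Real.exp (g y) * (q / Real.exp 1) ^ y / y.factorial

theorem selfPowerWeight_eq_expWeight (q : ℝ) :
    selfPowerWeight q = expWeight (fun y => y * Real.log y) q := by
  funext y
  rw [selfPowerWeight, expWeight]
  rcases Nat.eq_zero_or_pos y with rfl | hy
  · simp
  · rw [mul_comm (y : ℝ), Real.exp_mul, Real.exp_log (by exact_mod_cast hy), Real.rpow_natCast]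
    ring

theorem digammaWeight_eq_expWeight (q : ℝ) :
    digammaWeight q = expWeight (fun y => y * realDigamma y) q := by
  funext y
  rcases Nat.eq_zero_or_pos y with rfl | hy
  · simp [digammaWeight, expWeight]
  · rw [digammaWeight, if_neg hy.ne', expWeight]

theorem expWeight_pos (g : ℕ → ℝ) {q : ℝ} (hq : 0 < q) (y : ℕ) : 0 < expWeight g q y := by
  unfold expWeight; positivity

theorem expWeight_zero {g : ℕ → ℝ} (hg0 : g 0 = 0) (q : ℝ) : expWeight g q 0 = 1 := by
  simp [expWeight, hg0]

/-- Follows from `y^y / y! ≤ e^y`. This geometric majorant gives summability, finite mean,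
continuity in `q` and the bound `2` on the sum at `q = 1/2`. -/
theorem expWeight_le_pow {g : ℕ → ℝ} (hg : ∀ y : ℕ, g y ≤ y * Real.log y) {q : ℝ} (hq : 0 ≤ q)
    (y : ℕ) : expWeight g q y ≤ q ^ y := by
  have h1 : Real.exp (g y) ≤ (y : ℝ) ^ y := by
    refine (Real.exp_le_exp.2 (hg y)).trans (le_of_eq ?_)
    rcases Nat.eq_zero_or_pos y with rfl | hy
    · simp
    · rw [mul_comm (y : ℝ), Real.exp_mul, Real.exp_log (by exact_mod_cast hy), Real.rpow_natCast]
  have h2 := Real.pow_div_factorial_le_exp (y : ℝ) y.cast_nonneg y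
  have h3 : Real.exp 1 ^ y = Real.exp y := by rw [← Real.exp_nat_mul, mul_one]
  rw [expWeight, div_pow, h3]
  calc _ ≤ (y : ℝ) ^ y * (q ^ y / Real.exp y) / y.factorial := by gcongr
    _ = q ^ y * ((y : ℝ) ^ y / y.factorial / Real.exp y) := by ring
    _ ≤ q ^ y * 1 := by
        gcongr
        rw [div_le_one (Real.exp_pos _)]
        exact h2
    _ = q ^ y := mul_one _

theorem expWeight_mono (g : ℕ → ℝ) {q r : ℝ} (hq : 0 ≤ q) (hqr : q ≤ r) (y : ℕ) :
    expWeight g q y ≤ expWeight g r y := by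
  unfold expWeight; gcongr

theorem summable_expWeight {g : ℕ → ℝ} (hg : ∀ y : ℕ, g y ≤ y * Real.log y) {q : ℝ} (hq : 0 < q)
    (hq1 : q < 1) : Summable (expWeight g q) :=
  Summable.of_nonneg_of_le (fun y => (expWeight_pos g hq y).le)
    (fun y => expWeight_le_pow hg hq.le y) (summable_geometric_of_lt_one hq.le hq1)

theorem tsum_expWeight_pos {g : ℕ → ℝ} (hg : ∀ y : ℕ, g y ≤ y * Real.log y) {q : ℝ} (hq : 0 < q)
    (hq1 : q < 1) : 0 < ∑' y, expWeight g q y :=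
  (summable_expWeight hg hq hq1).tsum_pos (fun y => (expWeight_pos g hq y).le) 0
    (expWeight_pos g hq 0)

theorem lawOf_expWeight {g : ℕ → ℝ} (hg : ∀ y : ℕ, g y ≤ y * Real.log y) {q : ℝ}
    (hq : q ∈ Set.Ioo (0 : ℝ) 1) :
    (∀ y, 0 < lawOf (expWeight g q) y) ∧ HasSum (lawOf (expWeight g q)) 1 ∧
      Summable fun y : ℕ => (y : ℝ) * lawOf (expWeight g q) y := by
  have hS := tsum_expWeight_pos hg hq.1 hq.2
  have hN : 0 < normConst (expWeight g q) := inv_pos.2 hS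
  refine ⟨fun y => mul_pos hN (expWeight_pos g hq.1 y), ?_, ?_⟩
  · have h := (summable_expWeight hg hq.1 hq.2).hasSum.mul_left (normConst (expWeight g q))
    rwa [normConst, inv_mul_cancel₀ hS.ne'] at h
  · have h := (summable_pow_mul_geometric_of_norm_lt_one (R := ℝ) 1 (r := q)
      (by rw [Real.norm_of_nonneg hq.1.le]; exact hq.2)).mul_left (normConst (expWeight g q))
    refine Summable.of_nonneg_of_le (fun y => ?_) (fun y => ?_) h
    · exact mul_nonneg y.cast_nonneg (mul_pos hN (expWeight_pos g hq.1 y)).le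
    · rw [lawOf, pow_one, mul_left_comm]
      gcongr
      exact expWeight_le_pow hg hq.1.le y

theorem one_add_expWeight_le_tsum {g : ℕ → ℝ} (hg0 : g 0 = 0)
    (hg : ∀ y : ℕ, g y ≤ y * Real.log y) {q : ℝ} (hq : q ∈ Set.Ico (1 / 2 : ℝ) 1) :
    1 + expWeight g (1 / 2) 1 ≤ ∑' y, expWeight g q y := by
  have hq0 : 0 < q := by linarith [hq.1]
  have h := (summable_expWeight hg hq0 hq.2).sum_le_tsum (Finset.range 2)
    fun y _ => (expWeight_pos g hq0 y).le
  rw [Finset.sum_range_succ, Finset.sum_range_one, expWeight_zero hg0] at h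
  linarith [expWeight_mono g (by norm_num) hq.1 1]

theorem continuousOn_tsum_expWeight {g : ℕ → ℝ} (hg : ∀ y : ℕ, g y ≤ y * Real.log y) :
    ContinuousOn (fun q => ∑' y, expWeight g q y) (Set.Ico (1 / 2 : ℝ) 1) := by
  intro q hq
  obtain ⟨r, hqr, hr1⟩ := exists_between hq.2
  have hr0 : 0 < r := by linarith [hq.1]
  have h : ContinuousOn (fun q => ∑' y, expWeight g q y) (Set.Icc (1 / 2 : ℝ) r) := by
    refine continuousOn_tsum (fun y => ?_) (summable_geometric_of_lt_one hr0.le hr1)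
      fun y z hz => ?_
    · unfold expWeight
      fun_prop
    · have hz0 : 0 < z := by linarith [hz.1]
      rw [Real.norm_of_nonneg (expWeight_pos g hz0 y).le]
      exact (expWeight_mono g hz0.le hz.2 y).trans (expWeight_le_pow hg hr0.le y)
  refine (h q ⟨hq.1, hqr.le⟩).mono_of_mem_nhdsWithin ?_
  filter_upwards [self_mem_nhdsWithin, mem_nhdsWithin_of_mem_nhds (Iio_mem_nhds hqr)] with z hz hzr
  exact ⟨hz.1, le_of_lt hzr⟩

/-- A summable mass function as a discrete law. -/
noncomputable def pmfOfHasSum (f : ℕ → ℝ) (h0 : ∀ y, 0 ≤ f y) (h1 : HasSum f 1) : PMF ℕ :=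
  ⟨fun y => ENNReal.ofReal (f y), by
    have h := ENNReal.summable.hasSum (f := fun y => ENNReal.ofReal (f y))
    rwa [← ENNReal.ofReal_tsum_of_nonneg h0 h1.summable, h1.tsum_eq, ENNReal.ofReal_one] at h⟩

/-- If `𝔼[g(Y)] ≥ x log x` for every Poisson variable, the divergence of the Poisson laws from the
law with weights `exp (g y) (q / e) ^ y / y!` is at most affine in the mean. -/
theorem exists_discreteKL_poissonLaw_le {g : ℕ → ℝ} (hg0 : g 0 = 0)
    (hg : ∀ y : ℕ, g y ≤ y * Real.log y)
    (hgs : ∀ x, 0 ≤ x → Summable fun y => poissonWeight x y * g y)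
    (hge : ∀ x, 0 < x → x * Real.log x ≤ ∑' y, poissonWeight x y * g y) {q : ℝ}
    (hq : q ∈ Set.Ioo (0 : ℝ) 1) :
    ∃ Y : PMF ℕ, ∀ x : NNReal, discreteKL (poissonLaw x) Y ≤
      ENNReal.ofReal (Real.log (∑' y, expWeight g q y) + -Real.log q * x) := by
  obtain ⟨hpos, hsum, -⟩ := lawOf_expWeight hg hq
  have hS := tsum_expWeight_pos hg hq.1 hq.2
  refine ⟨pmfOfHasSum _ (fun y => (hpos y).le) hsum, fun x => ?_⟩
  have hYt : ∀ y, (pmfOfHasSum _ (fun y => (hpos y).le) hsum y).toReal =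
      lawOf (expWeight g q) y := fun y => ENNReal.toReal_ofReal (hpos y).le
  have hpt : ∀ y, (poissonLaw x y).toReal = poissonWeight x y := poissonLaw_toReal x
  -- The factorials cancel in the likelihood ratio, so its logarithm is an affine function of `y`
  -- minus `g y`.
  have hE := (((hasSum_poissonWeight (x : ℝ)).mul_left
    (-(x : ℝ) + Real.log (∑' y, expWeight g q y))).add
    ((hasSum_poissonWeight_mul_self (x : ℝ)).mul_left (Real.log x - Real.log q + 1))).sub
    (hgs x x.2).hasSum
  rw [discreteKL_eq_ofReal (F := fun y => -(x : ℝ) + Real.log (∑' y, expWeight g q y) +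
    (Real.log x - Real.log q + 1) * y - g y) _ _ (fun y hy => ?_) (fun y hy => ?_)
    (hE.congr_fun fun y => ?_)]
  · refine ENNReal.ofReal_le_ofReal ?_
    have key : (x : ℝ) * Real.log x ≤ ∑' y, poissonWeight x y * g y := by
      rcases eq_or_lt_of_le x.2 with h0 | h0
      · have h0' : (x : ℝ) = 0 := h0.symm
        rw [h0', zero_mul]
        have h1 : ∀ y, poissonWeight 0 y * g y = 0 := fun y => by
          rcases y with _ | y <;> simp [hg0, poissonWeight]
        simp [h1]
      · exact hge x h0
    nlinarith
  · have := ENNReal.ofReal_eq_zero.1 (show ENNReal.ofReal (lawOf (expWeight g q) y) = 0 from hy)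
    linarith [hpos y]
  · rw [hYt, hpt, lawOf, normConst, expWeight, poissonWeight]
    have hx : (x : ℝ) ^ y ≠ 0 := by
      intro h0
      apply hy
      rw [poissonLaw_apply, h0]
      simp
    have hq0 := hq.1
    have e : Real.exp (-x) * (x : ℝ) ^ y / y.factorial /
        ((∑' y, expWeight g q y)⁻¹ * (Real.exp (g y) * (q / Real.exp 1) ^ y / y.factorial)) =
        Real.exp (-x) * (x : ℝ) ^ y * (∑' y, expWeight g q y) /
          (Real.exp (g y) * (q / Real.exp 1) ^ y) := by
      field_simp
    rw [e, Real.log_div (by positivity) (by positivity), Real.log_mul (by positivity) hS.ne',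
      Real.log_mul (by positivity) hx, Real.log_mul (by positivity) (by positivity), Real.log_exp,
      Real.log_exp, Real.log_pow, Real.log_pow, Real.log_div hq0.ne' (by positivity), Real.log_exp]
    ring
  · rw [hpt]
    ring

end ExponentialWeights

/-! ### The balanced parameter `q`. -/

section Balance

/-- Intermediate values: at `q = 1/2` the left side wins because `log S ≤ log 2` and `1 - d ≤ -log
d`; near `q = 1` it tends to zero while `log S ≥ log (1 + c)`. -/
theorem exists_balanced {d : ℝ} (hd0 : 0 < d) (hd1 : d < 1) {S : ℝ → ℝ} {c : ℝ} (hc : 0 < c)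
    (hS : ContinuousOn S (Set.Ico (1 / 2 : ℝ) 1)) (hS2 : S (1 / 2) ≤ 2)
    (hSc : ∀ q ∈ Set.Ico (1 / 2 : ℝ) 1, 1 + c ≤ S q) :
    ∃ q ∈ Set.Ico (1 / 2 : ℝ) 1, -Real.log q * -Real.log d = (1 - d) * Real.log (S q) := by
  have hL : 0 < -Real.log d := neg_pos.2 (Real.log_neg hd0 hd1)
  have hdL : 1 - d ≤ -Real.log d := by linarith [Real.log_le_sub_one_of_pos hd0]
  have hlc : 0 < Real.log (1 + c) := Real.log_pos (by linarith)
  have hd : 0 < 1 - d := by linarith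
  -- The exponential solves `-log q * -log d = (1 - d) * log (1 + c)`.
  set q₂ : ℝ := max (1 / 2) (Real.exp (-((1 - d) * Real.log (1 + c) / -Real.log d))) with hq₂
  have hq₂0 : 1 / 2 ≤ q₂ := le_max_left _ _
  have hq₂1 : q₂ < 1 := by
    refine max_lt (by norm_num) ?_
    rw [Real.exp_lt_one_iff, neg_lt_zero]
    positivity
  have hsub : Set.Icc (1 / 2) q₂ ⊆ Set.Ico (1 / 2 : ℝ) 1 := fun z hz => ⟨hz.1, hz.2.trans_lt hq₂1⟩
  have hcont : ContinuousOn
      (fun q => (1 - d) * Real.log (S q) - -Real.log q * -Real.log d) (Set.Icc (1 / 2) q₂) := by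
    refine ContinuousOn.sub (continuousOn_const.mul ((hS.mono hsub).log fun z hz => ?_))
      ((ContinuousOn.neg (continuousOn_id.log fun z hz => ?_)).mul continuousOn_const)
    · linarith [hSc z (hsub hz)]
    · simp only [id]; linarith [hz.1]
  have hlow : (1 - d) * Real.log (S (1 / 2)) - -Real.log (1 / 2) * -Real.log d ≤ 0 := by
    have h1 : Real.log (S (1 / 2)) ≤ Real.log 2 :=
      Real.log_le_log (by linarith [hSc (1 / 2) ⟨le_rfl, by norm_num⟩]) hS2
    have h2 : Real.log (1 / 2) = -Real.log 2 := by rw [one_div, Real.log_inv]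
    have h3 : 0 < Real.log 2 := Real.log_pos (by norm_num)
    rw [h2, neg_neg]
    nlinarith
  have hhigh : 0 ≤ (1 - d) * Real.log (S q₂) - -Real.log q₂ * -Real.log d := by
    have h1 : Real.log (1 + c) ≤ Real.log (S q₂) :=
      Real.log_le_log (by linarith) (hSc q₂ ⟨hq₂0, hq₂1⟩)
    have h2 : -((1 - d) * Real.log (1 + c) / -Real.log d) ≤ Real.log q₂ := by
      rw [Real.le_log_iff_exp_le (by linarith)]
      exact le_max_right _ _
    have h3 : -Real.log q₂ * -Real.log d ≤ (1 - d) * Real.log (1 + c) := by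
      rw [← le_div_iff₀ hL]; linarith
    nlinarith
  obtain ⟨q, hq, hq0⟩ := intermediate_value_Icc hq₂0 hcont ⟨hlow, hhigh⟩
  exact ⟨q, hsub hq, by simp only at hq0; linarith⟩

/-- A mediant: balance makes the value times the denominator equal to `μ * a + b`, and `μ' ≥ μ` only
enlarges the numerator. -/
theorem le_div_of_balanced {d a b μ μ' : ℝ} (hd0 : 0 < d) (hd1 : d < 1) (ha : 0 ≤ a)
    (hμ : 0 ≤ μ) (hμ' : μ ≤ μ') (h : a * -Real.log d = (1 - d) * b) :
    a * -Real.log d ≤ (μ' * a + b) / (-μ / Real.log d + 1 / (1 - d)) := by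
  have hL : 0 < -Real.log d := neg_pos.2 (Real.log_neg hd0 hd1)
  have hL0 : Real.log d ≠ 0 := by linarith
  have hd : 0 < 1 - d := by linarith
  have e : -μ / Real.log d = μ / -Real.log d := by rw [div_neg, neg_div]
  have hden : 0 < μ / -Real.log d + 1 / (1 - d) := by positivity
  rw [e, le_div_iff₀ hden, mul_add]
  have h1 : a * -Real.log d * (μ / -Real.log d) = μ * a := by field_simp
  have h2 : a * -Real.log d * (1 / (1 - d)) = b := by rw [h]; field_simp
  rw [h1, h2]
  gcongr

end Balance

/-! ### Comparison of digamma weights with central binomial coefficients. -/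

section CentralBinomial

theorem multichoose_half (n : ℕ) :
    Ring.multichoose (1 / 2 : ℝ) n = n.centralBinom / 4 ^ n := by
  have h := Ring.factorial_nsmul_multichoose_eq_ascPochhammer (1 / 2 : ℝ) n
  rw [Polynomial.ascPochhammer_smeval_eq_eval, nsmul_eq_mul] at h
  have h2 : ∀ n : ℕ, (ascPochhammer ℝ n).eval (1 / 2) = n.factorial * (n.centralBinom / 4 ^ n) := by
    intro n
    induction n with
    | zero => simp
    | succ n ih =>
      have h3 := Nat.succ_mul_centralBinom_succ n
      have h4 : ((n : ℝ) + 1) * (n + 1).centralBinom = 2 * (2 * n + 1) * n.centralBinom := by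
        exact_mod_cast h3
      rw [ascPochhammer_succ_eval, ih, Nat.factorial_succ]
      push_cast
      rw [pow_succ]
      field_simp
      linear_combination -2 * h4
  rw [h2] at h
  exact mul_left_cancel₀ (by positivity) h

theorem hasSum_centralBinom {q : ℝ} (hq : q ∈ Set.Ioo (0 : ℝ) 1) :
    HasSum (fun n : ℕ => (n.centralBinom / 4 ^ n : ℝ) * q ^ n) (1 / √(1 - q)) := by
  have h := (Real.one_div_one_sub_rpow_hasFPowerSeriesOnBall_zero (1 / 2)).hasSum (y := q)
    (by simpa [enorm_eq_nnnorm, ← NNReal.coe_lt_one, abs_of_pos hq.1] using hq.2)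
  rw [zero_add, ← Real.sqrt_eq_rpow] at h
  refine h.congr_fun fun n => ?_
  rw [FormalMultilinearSeries.ofScalars_apply_eq, ← Ring.multichoose_eq, multichoose_half,
    smul_eq_mul]

theorem gammaHi_pos : 0 < gammaHi := by unfold gammaHi; positivity

theorem gammaLo_pos : 0 < gammaLo := by unfold gammaLo; positivity

theorem gammaHi_le_one : gammaHi ≤ 1 := by
  rw [gammaHi, div_le_one (by positivity), Real.one_le_sqrt]
  linarith [Real.add_one_le_exp 1]

/-- The digamma weight at `n + 1`, without its power of `q`, divided by `C(2n+2, n+1) / 4 ^ (n+1)`. -/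
noncomputable def digammaRatio (n : ℕ) : ℝ :=
  expWeight (fun y => y * realDigamma y) 1 (n + 1) /
    ((n + 1).centralBinom / 4 ^ (n + 1))

theorem digammaRatio_zero : digammaRatio 0 = gammaLo := by
  have h := realDigamma_succ 0
  simp only [zero_add, Nat.cast_one, harmonic_zero, Rat.cast_zero, zero_sub] at h
  simp only [digammaRatio, expWeight, gammaLo, zero_add, Nat.cast_one, h, pow_one, one_mul,
    Nat.factorial_one, div_one, show Nat.centralBinom 1 = 2 from rfl]
  rw [Real.exp_add, Real.exp_neg]
  push_cast
  field_simp
  norm_num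

theorem digammaRatio_monotone : Monotone digammaRatio := by
  refine monotone_nat_of_le_succ fun n => ?_
  have hc : ((n : ℝ) + 1 + 1) * (n + 1 + 1).centralBinom =
      2 * (2 * (n + 1) + 1) * (n + 1).centralBinom := by
    exact_mod_cast Nat.succ_mul_centralBinom_succ (n + 1)
  have hpos : (0 : ℝ) < (n + 1).centralBinom := by exact_mod_cast Nat.centralBinom_pos _
  set E := Real.exp (realDigamma ((n + 1 + 1 : ℕ) : ℝ)) with hE
  have hElow : (n : ℝ) + 1 + 1 / 2 ≤ E := by
    have h := log_add_half_le_realDigamma (n + 1)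
    rw [Real.log_le_iff_le_exp (by positivity)] at h
    push_cast at h
    exact_mod_cast h
  -- From `(n + 1) (ψ(n+2) - ψ(n+1)) = 1`. The quotient of consecutive ratios is then `exp ψ(n+2) /
  -- (n + 3/2)`, at least `1` by `log_add_half_le_realDigamma`.
  have hexp : Real.exp (((n + 1 + 1 : ℕ) : ℝ) * realDigamma ((n + 1 + 1 : ℕ) : ℝ)) =
      Real.exp (((n + 1 : ℕ) : ℝ) * realDigamma ((n + 1 : ℕ) : ℝ)) * E * Real.exp 1 := by
    rw [hE, ← Real.exp_add, ← Real.exp_add, realDigamma_succ, realDigamma_succ, harmonic_succ_real]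
    congr 1
    push_cast
    field_simp
    ring
  have key : digammaRatio (n + 1) = digammaRatio n * (E / (n + 1 + 1 / 2)) := by
    simp only [digammaRatio, expWeight]
    rw [hexp, Nat.factorial_succ (n + 1)]
    have hcb : ((n + 1 + 1).centralBinom : ℝ) =
        2 * (2 * (n + 1) + 1) * (n + 1).centralBinom / (n + 1 + 1) := by
      rw [eq_div_iff (by positivity)]; linear_combination hc
    rw [hcb, pow_succ _ (n + 1), pow_succ _ (n + 1)]
    push_cast
    field_simp
    ring
  rw [key]
  refine le_mul_of_one_le_right ?_ ?_
  · unfold digammaRatio expWeight; positivity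
  · rwa [one_le_div (by positivity)]

theorem digammaRatio_le_stirling (n : ℕ) :
    digammaRatio n ≤ Real.exp (-(1 / 2)) *
      (Stirling.stirlingSeq (n + 1) / (√2 * Stirling.stirlingSeq (2 * (n + 1)))) := by
  have h1 : Real.exp (((n + 1 : ℕ) : ℝ) * realDigamma ((n + 1 : ℕ) : ℝ)) ≤
      ((n : ℝ) + 1) ^ (n + 1) * Real.exp (-(1 / 2)) := by
    have h2 : ((n : ℝ) + 1) ^ (n + 1) = Real.exp (((n + 1 : ℕ) : ℝ) * Real.log (n + 1)) := by
      rw [mul_comm, Real.exp_mul, Real.exp_log (by positivity), Real.rpow_natCast]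
    rw [h2, ← Real.exp_add, Real.exp_le_exp]
    refine (mul_le_mul_of_nonneg_left (realDigamma_le_log_sub n) (Nat.cast_nonneg _)).trans
      (le_of_eq ?_)
    push_cast
    field_simp
    ring
  have hcb : ((n + 1).centralBinom : ℝ) =
      (2 * (n + 1)).factorial / ((n + 1).factorial * (n + 1).factorial) := by
    rw [Nat.centralBinom, Nat.cast_choose ℝ (by omega)]
    congr 3
    congr 1
    omega
  calc digammaRatio n ≤ ((n : ℝ) + 1) ^ (n + 1) * Real.exp (-(1 / 2)) * (1 / Real.exp 1) ^ (n + 1) /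
        (n + 1).factorial / ((n + 1).centralBinom / 4 ^ (n + 1)) := by
        unfold digammaRatio expWeight; gcongr
    _ = _ := by
        rw [hcb, Stirling.stirlingSeq, Stirling.stirlingSeq]
        have hs : √(2 * ((2 * (n + 1) : ℕ) : ℝ)) = √2 * √(2 * ((n + 1 : ℕ) : ℝ)) := by
          rw [← Real.sqrt_mul (by norm_num)]
          push_cast
          ring_nf
        rw [hs]
        have hp : (((2 * (n + 1) : ℕ) : ℝ) / Real.exp 1) ^ (2 * (n + 1)) =
            4 ^ (n + 1) * (((n : ℝ) + 1) / Real.exp 1) ^ (n + 1) *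
              (((n : ℝ) + 1) / Real.exp 1) ^ (n + 1) := by
          rw [pow_mul, ← mul_pow, ← mul_pow]
          congr 1
          push_cast
          ring
        rw [hp, div_pow, div_pow]
        push_cast
        rw [div_pow]
        field_simp
        rw [one_pow]

/-- The ratios increase, and by Stirling their majorants tend to `e^(-1/2) / √2`, which is
`gammaHi`. -/
theorem digammaRatio_le (n : ℕ) : digammaRatio n ≤ gammaHi := by
  have hlim : Filter.Tendsto (fun n : ℕ => Real.exp (-(1 / 2)) *
      (Stirling.stirlingSeq (n + 1) / (√2 * Stirling.stirlingSeq (2 * (n + 1))))) Filter.atTop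
      (nhds gammaHi) := by
    have hs := Stirling.tendsto_stirlingSeq_sqrt_pi
    have h1 := hs.comp (Filter.tendsto_add_atTop_nat 1)
    have h2 : Filter.Tendsto (fun n : ℕ => 2 * (n + 1)) Filter.atTop Filter.atTop :=
      Filter.tendsto_atTop_mono (fun n => show n ≤ 2 * (n + 1) by omega) Filter.tendsto_id
    have hpi : √Real.pi ≠ 0 := by positivity
    have h3 := (h1.div ((hs.comp h2).const_mul √2) (by positivity)).const_mul (Real.exp (-(1 / 2)))
    have e : Real.exp (-(1 / 2)) * (√Real.pi / (√2 * √Real.pi)) = gammaHi := by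
      rw [gammaHi, Real.sqrt_mul (by norm_num), Real.exp_neg, Real.exp_half]
      field_simp
    rw [e] at h3
    exact h3
  refine ge_of_tendsto hlim ?_
  filter_upwards [Filter.eventually_ge_atTop n] with m hm
  exact (digammaRatio_monotone hm).trans (digammaRatio_le_stirling m)

theorem gammaLo_le_gammaHi : gammaLo ≤ gammaHi := digammaRatio_zero ▸ digammaRatio_le 0

theorem tsum_expWeight_digamma_le {q : ℝ} (hq : q ∈ Set.Ioo (0 : ℝ) 1) :
    ∑' y, expWeight (fun y => y * realDigamma y) q y ≤ 1 + gammaHi * (1 / √(1 - q) - 1) := by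
  have hs := summable_expWeight mul_realDigamma_le hq.1 hq.2
  have h := hasSum_centralBinom hq
  rw [← hasSum_nat_add_iff' 1] at h
  simp only [Finset.range_one, Finset.sum_singleton, Nat.centralBinom_zero, pow_zero, Nat.cast_one,
    div_one, mul_one] at h
  rw [hs.tsum_eq_zero_add, expWeight_zero (by simp)]
  gcongr
  refine hasSum_le (fun n => ?_) ((summable_nat_add_iff 1).2 hs).hasSum (h.mul_left gammaHi)
  have hpos : (0 : ℝ) < (n + 1).centralBinom := by exact_mod_cast Nat.centralBinom_pos _
  have h1 := digammaRatio_le n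
  rw [digammaRatio, div_le_iff₀ (by positivity)] at h1
  have hq0 := hq.1
  calc expWeight (fun y => y * realDigamma y) q (n + 1)
      = expWeight (fun y => y * realDigamma y) 1 (n + 1) * q ^ (n + 1) := by
        simp only [expWeight, div_pow, one_pow]; ring
    _ ≤ gammaHi * ((n + 1).centralBinom / 4 ^ (n + 1)) * q ^ (n + 1) := by gcongr
    _ = _ := by ring

end CentralBinomial

/-! ### Assembly of the capacity bounds. -/

section Main

/-- `S` may exceed the true sum: an affine divergence bound survives enlarging its constant term.
This allows balancing with the closed-form majorant. -/
theorem poissonRepeatCapacity_le_of_expWeight {d : ℝ} (hd0 : 0 < d) (hd1 : d < 1) {g : ℕ → ℝ}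
    (hg0 : g 0 = 0) (hg : ∀ y : ℕ, g y ≤ y * Real.log y)
    (hgs : ∀ x, 0 ≤ x → Summable fun y => poissonWeight x y * g y)
    (hge : ∀ x, 0 < x → x * Real.log x ≤ ∑' y, poissonWeight x y * g y) {S : ℝ} {q : ℝ}
    (hq : q ∈ Set.Ioo (0 : ℝ) 1) (hS : ∑' y, expWeight g q y ≤ S) (hS1 : 1 ≤ S)
    (hbal : -Real.log q * -Real.log d = (1 - d) * Real.log S) :
    (poissonRepeatCapacity d : EReal) ≤ ((-Real.log q * -Real.log d : ℝ) : EReal) := by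
  obtain ⟨Y, hY⟩ := exists_discreteKL_poissonLaw_le hg0 hg hgs hge hq
  have hlq : 0 ≤ -Real.log q := (neg_pos.2 (Real.log_neg hq.1 hq.2)).le
  have hC : 0 ≤ -Real.log q * -Real.log d :=
    mul_nonneg hlq (neg_pos.2 (Real.log_neg hd0 hd1)).le
  have h := poissonRepeatCapacity_le hd0 hd1 Y hlq (Real.log_nonneg hS1) rfl hbal.symm fun x =>
    (hY x).trans (ENNReal.ofReal_le_ofReal
      (add_le_add_left (Real.log_le_log (tsum_expWeight_pos hg hq.1 hq.2) hS) _))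
  calc (poissonRepeatCapacity d : EReal)
      ≤ (ENNReal.ofReal (-Real.log q * -Real.log d) : EReal) := EReal.coe_ennreal_le_coe_ennreal_iff.2 h
    _ = _ := by rw [EReal.coe_ennreal_ofReal, max_eq_left hC]

theorem poissonRepeatCapacity_le_iSup_expWeight {d : ℝ} (hd0 : 0 < d) (hd1 : d < 1) {g : ℕ → ℝ}
    (hg0 : g 0 = 0) (hg : ∀ y : ℕ, g y ≤ y * Real.log y)
    (hgs : ∀ x, 0 ≤ x → Summable fun y => poissonWeight x y * g y)
    (hge : ∀ x, 0 < x → x * Real.log x ≤ ∑' y, poissonWeight x y * g y) :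
    (poissonRepeatCapacity d : EReal) ≤
      ⨆ q ∈ Set.Ioo (0 : ℝ) 1,
        (((-meanOf (expWeight g q) * Real.log q - Real.log (normConst (expWeight g q))) /
          (-meanOf (expWeight g q) / Real.log d + 1 / (1 - d)) : ℝ) : EReal) := by
  have hc := expWeight_pos g (by norm_num : (0 : ℝ) < 1 / 2) 1
  have hS2 : ∑' y, expWeight g (1 / 2) y ≤ 2 := by
    refine ((summable_expWeight hg (by norm_num) (by norm_num)).tsum_le_tsum
      (fun y => expWeight_le_pow hg (by norm_num) y) summable_geometric_two).trans ?_
    rw [tsum_geometric_two]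
  obtain ⟨q, hq', hbal⟩ := exists_balanced hd0 hd1 hc (continuousOn_tsum_expWeight hg) hS2
    fun q hq => one_add_expWeight_le_tsum hg0 hg hq
  have hq : q ∈ Set.Ioo (0 : ℝ) 1 := ⟨by linarith [hq'.1], hq'.2⟩
  have hS1 : 1 ≤ ∑' y, expWeight g q y := by linarith [one_add_expWeight_le_tsum hg0 hg hq']
  refine (poissonRepeatCapacity_le_of_expWeight hd0 hd1 hg0 hg hgs hge hq le_rfl hS1 hbal).trans ?_
  refine le_trans (EReal.coe_le_coe_iff.2 ?_) (le_iSup₂_of_le q hq le_rfl)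
  have hmean : 0 ≤ meanOf (expWeight g q) :=
    tsum_nonneg fun y => mul_nonneg y.cast_nonneg ((lawOf_expWeight hg hq).1 y).le
  refine (le_div_of_balanced hd0 hd1 (neg_pos.2 (Real.log_neg hq.1 hq.2)).le hmean le_rfl
    hbal).trans (le_of_eq ?_)
  rw [normConst, Real.log_inv]
  ring

theorem muLo_nonneg {q : ℝ} (hq : q ∈ Set.Ioo (0 : ℝ) 1) : 0 ≤ muLo q := by
  have h1 : 0 < √(1 - q) := Real.sqrt_pos.2 (by linarith [hq.2])
  have h2 : 0 ≤ 1 - √(1 - q) := by rw [sub_nonneg, Real.sqrt_le_iff]; constructor <;> linarith [hq.1]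
  have h3 : 0 < 1 - q := by linarith [hq.2]
  have := gammaLo_pos
  have := gammaHi_pos
  have := hq.1
  unfold muLo
  positivity

theorem muLo_le_muHi {q : ℝ} (hq : q ∈ Set.Ioo (0 : ℝ) 1) : muLo q ≤ muHi q := by
  have h1 : 0 < √(1 - q) := Real.sqrt_pos.2 (by linarith [hq.2])
  have h2 : 0 ≤ 1 - √(1 - q) := by rw [sub_nonneg, Real.sqrt_le_iff]; constructor <;> linarith [hq.1]
  have h3 : 0 < 1 - q := by linarith [hq.2]
  have := gammaLo_pos
  have := gammaHi_pos
  have := hq.1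
  have := gammaLo_le_gammaHi
  unfold muLo muHi
  gcongr

theorem poissonRepeatCapacity_le_iSup_elementary {d : ℝ} (hd0 : 0 < d) (hd1 : d < 1) :
    (poissonRepeatCapacity d : EReal) ≤
      ⨆ q ∈ Set.Ioo (0 : ℝ) 1,
        (((-muHi q * Real.log q - Real.log (y0Lo q)) /
          (-muLo q / Real.log d + 1 / (1 - d)) : ℝ) : EReal) := by
  have hsqrt : ∀ q ∈ Set.Ico (1 / 2 : ℝ) 1, 0 < √(1 - q) ∧ √(1 - q) ≤ √(1 / 2) := fun q hq =>
    ⟨Real.sqrt_pos.2 (by linarith [hq.2]), Real.sqrt_le_sqrt (by linarith [hq.1])⟩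
  have hhalf : √(1 / 2 : ℝ) < 1 := by rw [Real.sqrt_lt' one_pos]; norm_num
  have hhalf0 : 0 < √(1 / 2 : ℝ) := by positivity
  have hhalf' : 0 < 1 / √(1 / 2 : ℝ) - 1 := by
    rw [sub_pos, lt_div_iff₀ hhalf0, one_mul]; exact hhalf
  have hcont : ContinuousOn (fun q => 1 + gammaHi * (1 / √(1 - q) - 1)) (Set.Ico (1 / 2 : ℝ) 1) := by
    refine continuousOn_const.add (continuousOn_const.mul (ContinuousOn.sub
      (continuousOn_const.div (by fun_prop) fun q hq => (hsqrt q hq).1.ne') continuousOn_const))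
  have hlow : ∀ q ∈ Set.Ico (1 / 2 : ℝ) 1,
      1 + gammaHi * (1 / √(1 / 2) - 1) ≤ 1 + gammaHi * (1 / √(1 - q) - 1) := fun q hq => by
    have := gammaHi_pos
    have h1 := (hsqrt q hq).1
    have h2 := (hsqrt q hq).2
    gcongr
  have htwo : 1 + gammaHi * (1 / √(1 - 1 / 2) - 1) ≤ 2 := by
    have h1 : 1 / √(1 / 2 : ℝ) ≤ 2 := by
      rw [div_le_iff₀ hhalf0]
      have : (1 / 2 : ℝ) ≤ √(1 / 2) := Real.le_sqrt_of_sq_le (by norm_num)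
      linarith
    rw [show (1 : ℝ) - 1 / 2 = 1 / 2 by norm_num]
    nlinarith [gammaHi_le_one]
  obtain ⟨q, hq', hbal⟩ := exists_balanced hd0 hd1 (mul_pos gammaHi_pos hhalf') hcont htwo hlow
  have hq : q ∈ Set.Ioo (0 : ℝ) 1 := ⟨by linarith [hq'.1], hq'.2⟩
  have hS1 : 1 ≤ 1 + gammaHi * (1 / √(1 - q) - 1) := by
    linarith [hlow q hq', mul_pos gammaHi_pos hhalf']
  refine (poissonRepeatCapacity_le_of_expWeight hd0 hd1 (g := fun y => y * realDigamma y) (by simp)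
    mul_realDigamma_le (fun x hx => summable_poissonWeight_mul_digamma hx)
    (fun x hx => mul_log_le_tsum_poissonWeight_digamma hx) hq (tsum_expWeight_digamma_le hq) hS1
    hbal).trans ?_
  refine le_trans (EReal.coe_le_coe_iff.2 ?_) (le_iSup₂_of_le q hq le_rfl)
  refine (le_div_of_balanced hd0 hd1 (neg_pos.2 (Real.log_neg hq.1 hq.2)).le (muLo_nonneg hq)
    (muLo_le_muHi hq) hbal).trans (le_of_eq ?_)
  rw [y0Lo, Real.log_inv]
  ring

end Main

/-- The suprema are taken in `EReal`, where they have their true value even if the family were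
unbounded. -/
theorem mainTheorem8 (d : ℝ) (hd0 : 0 < d) (hd1 : d < 1) :
    (∀ w : ℝ → ℕ → ℝ, w = selfPowerWeight ∨ w = digammaWeight →
      (∀ q ∈ Set.Ioo (0 : ℝ) 1,
        (∀ y, 0 ≤ lawOf (w q) y) ∧ HasSum (lawOf (w q)) 1 ∧
          Summable fun y : ℕ => (y : ℝ) * lawOf (w q) y) ∧
      (poissonRepeatCapacity d : EReal) ≤
        ⨆ q ∈ Set.Ioo (0 : ℝ) 1,
          (((-meanOf (w q) * Real.log q - Real.log (normConst (w q))) /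
            (-meanOf (w q) / Real.log d + 1 / (1 - d)) : ℝ) : EReal)) ∧
    (poissonRepeatCapacity d : EReal) ≤
      ⨆ q ∈ Set.Ioo (0 : ℝ) 1,
        (((-muHi q * Real.log q - Real.log (y0Lo q)) /
          (-muLo q / Real.log d + 1 / (1 - d)) : ℝ) : EReal) := by
  refine ⟨?_, poissonRepeatCapacity_le_iSup_elementary hd0 hd1⟩
  have hlaw : ∀ {g : ℕ → ℝ}, (∀ y : ℕ, g y ≤ y * Real.log y) → ∀ q ∈ Set.Ioo (0 : ℝ) 1,
      (∀ y, 0 ≤ lawOf (expWeight g q) y) ∧ HasSum (lawOf (expWeight g q)) 1 ∧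
        Summable fun y : ℕ => (y : ℝ) * lawOf (expWeight g q) y := fun hg q hq =>
    ⟨fun y => ((lawOf_expWeight hg hq).1 y).le, (lawOf_expWeight hg hq).2⟩
  rintro w (rfl | rfl)
  · simp only [selfPowerWeight_eq_expWeight]
    exact ⟨hlaw fun _ => le_rfl, poissonRepeatCapacity_le_iSup_expWeight hd0 hd1 (by simp)
      (fun _ => le_rfl) (fun x hx => summable_poissonWeight_mul_log hx)
      (fun x hx => mul_log_le_tsum_poissonWeight hx)⟩
  · simp only [digammaWeight_eq_expWeight]
    exact ⟨hlaw mul_realDigamma_le, poissonRepeatCapacity_le_iSup_expWeight hd0 hd1 (by simp)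
      mul_realDigamma_le (fun x hx => summable_poissonWeight_mul_digamma hx)
      (fun x hx => mul_log_le_tsum_poissonWeight_digamma hx)⟩
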